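/- Let $\ell>0$, $R_1>0$, $S^1=\mathbb R/\ell\mathbb Z$. Consider smooth functions $U,A,\eta,a,G,H$ of $(R,\theta)$, $0<R<R_1$, $\theta\in S^1$, with $a>0$, such that the Lorentzian metric $$g=e^{2(\eta-U)}\left(-dR^2+a^{-2}d\theta^2\right)+e^{2U}\left(dx^1+A\,dx^2+(G+AH)\,d\theta\right)^2+e^{-2U}R^2\left(dx^2+H\,d\theta\right)^2$$ of a four-dimensional spacetime with a free spatial $T^2$-symmetry is Ricci-flat. (More generally, the local system of torus fibres over $S^1$ may have holonomy fixing $x^2$: on the universal cover, for some constant $c$, the functions $U,\eta,a,H$ are $\ell$-periodic in $\theta$, while $A(R,\theta+\ell)=A(R,\theta)+c$ and $G(R,\theta+\ell)=G(R,\theta)-c\,H(R,\theta)$. The case $c=0$ is that of a global $T^2$-action.) Let $(G_{IJ})=\begin{pmatrix}e^{2U}&e^{2U}A\\ e^{2U}A&e^{2U}A^2+e^{-2U}R^2\end{pmatrix}$ be the metric on the torus fibres and let $$C_I=\left(e^{2(\eta-U)}a^{-1}\right)^{-1}R\,\left(G_{I1}\,\partial_RG+G_{I2}\,\partial_RH\right),\qquad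 I=1,2,$$ be the twist quantities. Assume that the spacetime is not Gowdy, with $x^1,x^2$ chosen so that $C_1=0$ and $C_2=K$ for a constant $K>0$. Put $R=e^{-\tau}$. For a smooth function $\sigma$ on $S^1$ and $e^{-\tau}<R_1$ put $$\|\sigma\|_{H^{-1}_\tau}=\sup_{\varphi}\ \frac{\int_{S^1}\sigma\,\varphi\,a^{-1}\,d\theta}{\sqrt{\int_{S^1}\left(\varphi^2+a^2\varphi_\theta^2\right)a^{-1}\,d\theta}},$$ where $a$ is taken at time $\tau$ and $\varphi$ ranges over the smooth functions on $S^1$ that are not identically zero. Let $\tau_0$ satisfy $e^{-\tau_0}<R_1$. If $\int_{S^1}H\,d\theta$ is bounded below as $\tau\to\infty$, and $$\int_{\tau_0}^\infty e^{2\tau}\left\|e^{4U}a^2A_\theta^2\right\|_{H^{-1}_\tau}^2\,d\tau<\infty,$$ then $$\int_{\tau_0}^\infty e^{2\tau}\left\|a\left(a^{-1}U_\tau\right)_\tau-\tfrac12e^{2\tau}e^{4U}A_\tau^2\right\|_{H^{-1}_\tau}^2\,d\tau<\infty.$$ -/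

import Mathlib

open MeasureTheory Filter Set
open scoped ENNReal ContDiff Matrix

noncomputable section

/-! ### Ricci curvature of a metric given in coordinates on an open subset of `ℝ⁴` -/

/-- The partial derivative `∂_i f` at the point `p`. -/
def coordDeriv (i : Fin 4) (f : (Fin 4 → ℝ) → ℝ) (p : Fin 4 → ℝ) : ℝ :=
  deriv (fun t : ℝ => f (Function.update p i t)) (p i)

/-- Christoffel symbols of the Levi-Civita connection,
`Γ^k_{ij} = ½ g^{kl} (∂_i g_{jl} + ∂_j g_{il} - ∂_l g_{ij})`. -/
def christoffel (g : (Fin 4 → ℝ) → Matrix (Fin 4) (Fin 4) ℝ) (k i j : Fin 4)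
    (p : Fin 4 → ℝ) : ℝ :=
  (1 / 2) * ∑ l, (g p)⁻¹ k l *
    (coordDeriv i (fun q => g q j l) p + coordDeriv j (fun q => g q i l) p
      - coordDeriv l (fun q => g q i j) p)

/-- Ricci tensor
`R_{ij} = ∂_k Γ^k_{ij} - ∂_j Γ^k_{ik} + Γ^k_{kl} Γ^l_{ij} - Γ^k_{jl} Γ^l_{ik}`. -/
def ricci (g : (Fin 4 → ℝ) → Matrix (Fin 4) (Fin 4) ℝ) (i j : Fin 4)
    (p : Fin 4 → ℝ) : ℝ :=
  ∑ k, (coordDeriv k (christoffel g k i j) p - coordDeriv j (christoffel g k i k) p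
    + ∑ l, (christoffel g k k l p * christoffel g l i j p
      - christoffel g k j l p * christoffel g l i k p))

/-! ### Torus-symmetric metrics in areal coordinates -/

/-- The coefficient functions, in the variables `(R, θ)`, of the metric
`e^{2(η-U)} (-dR² + a⁻² dθ²) + e^{2U} (dx¹ + A dx² + (G + A H) dθ)² + e^{-2U} R² (dx² + H dθ)²`. -/
structure ArealCoeffs where
  U : ℝ → ℝ → ℝ
  A : ℝ → ℝ → ℝ
  η : ℝ → ℝ → ℝ
  a : ℝ → ℝ → ℝ
  G : ℝ → ℝ → ℝ
  H : ℝ → ℝ → ℝ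

namespace ArealCoeffs

/-- The matrix of the spacetime metric in the coordinates `(R, θ, x¹, x²) = (p 0, p 1, p 2, p 3)`;
`vecMulVec ω ω` is the square of the one-form with components `ω`. -/
def metric (S : ArealCoeffs) (p : Fin 4 → ℝ) : Matrix (Fin 4) (Fin 4) ℝ :=
  let R := p 0
  let θ := p 1
  let dR : Fin 4 → ℝ := ![1, 0, 0, 0]
  let dθ : Fin 4 → ℝ := ![0, 1, 0, 0]
  let ω₁ : Fin 4 → ℝ := ![0, S.G R θ + S.A R θ * S.H R θ, 1, S.A R θ]
  let ω₂ : Fin 4 → ℝ := ![0, S.H R θ, 0, 1]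
  Real.exp (2 * (S.η R θ - S.U R θ)) •
      (-Matrix.vecMulVec dR dR + ((S.a R θ) ^ 2)⁻¹ • Matrix.vecMulVec dθ dθ)
    + Real.exp (2 * S.U R θ) • Matrix.vecMulVec ω₁ ω₁
    + (Real.exp (-(2 * S.U R θ)) * R ^ 2) • Matrix.vecMulVec ω₂ ω₂

/-- The inner product `G_{IJ}` on the torus fibres, i.e. the metric restricted to `∂_{x¹}, ∂_{x²}`;
its determinant is `R²`. -/
def fiberMetric (S : ArealCoeffs) (R θ : ℝ) : Matrix (Fin 2) (Fin 2) ℝ :=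
  !![Real.exp (2 * S.U R θ), Real.exp (2 * S.U R θ) * S.A R θ;
     Real.exp (2 * S.U R θ) * S.A R θ,
     Real.exp (2 * S.U R θ) * S.A R θ ^ 2 + Real.exp (-(2 * S.U R θ)) * R ^ 2]

/-- The twist quantities `C_I = L⁻¹ h^{-1/2} √(det G) G_{IK} F^K_{Rθ}`. Here the metric on the
`(R, θ)`-base is `-L² dR² + h dθ²`, so that `L h^{1/2} = e^{2(η-U)} a⁻¹`, and `F = d(G dθ, H dθ)`
is the curvature of the connection of the torus bundle. -/
def twist (S : ArealCoeffs) (R θ : ℝ) : Fin 2 → ℝ :=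
  ((Real.exp (2 * (S.η R θ - S.U R θ)) * (S.a R θ)⁻¹)⁻¹ * R) •
    (S.fiberMetric R θ *ᵥ ![deriv (fun r => S.G r θ) R, deriv (fun r => S.H r θ) R])

/-- `S` describes a smooth vacuum spacetime with a free spatial `T²`-symmetry, over the base
`(0, R₁) × S¹` with `S¹ = ℝ/ℓℤ`, that is not Gowdy: the twist vector is `(0, K)` with `K > 0`.
The functions are written on the universal cover. The number `c` describes the holonomy
`x¹ ↦ x¹ + c x²` around `S¹` of the local system of torus fibres; for `c = 0` there is a global
action of `T²`, and all coefficients are functions on the circle. -/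
structure IsTwistedVacuum (S : ArealCoeffs) (ℓ R₁ K : ℝ) : Prop where
  length_pos : 0 < ℓ
  time_pos : 0 < R₁
  smooth_U : ContDiffOn ℝ ∞ (Function.uncurry S.U) (Ioo 0 R₁ ×ˢ univ)
  smooth_A : ContDiffOn ℝ ∞ (Function.uncurry S.A) (Ioo 0 R₁ ×ˢ univ)
  smooth_η : ContDiffOn ℝ ∞ (Function.uncurry S.η) (Ioo 0 R₁ ×ˢ univ)
  smooth_a : ContDiffOn ℝ ∞ (Function.uncurry S.a) (Ioo 0 R₁ ×ˢ univ)
  smooth_G : ContDiffOn ℝ ∞ (Function.uncurry S.G) (Ioo 0 R₁ ×ˢ univ)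
  smooth_H : ContDiffOn ℝ ∞ (Function.uncurry S.H) (Ioo 0 R₁ ×ˢ univ)
  periodic : ∃ c : ℝ, ∀ R ∈ Ioo 0 R₁, ∀ θ,
    S.U R (θ + ℓ) = S.U R θ ∧ S.η R (θ + ℓ) = S.η R θ ∧ S.a R (θ + ℓ) = S.a R θ ∧
    S.H R (θ + ℓ) = S.H R θ ∧ S.A R (θ + ℓ) = S.A R θ + c ∧
    S.G R (θ + ℓ) = S.G R θ - c * S.H R θ
  a_pos : ∀ R ∈ Ioo 0 R₁, ∀ θ, 0 < S.a R θ
  ricci_flat : ∀ p : Fin 4 → ℝ, p 0 ∈ Ioo 0 R₁ → ∀ i j, ricci S.metric i j p = 0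
  twist_pos : 0 < K
  twist_eq : ∀ R ∈ Ioo 0 R₁, ∀ θ, S.twist R θ = ![0, K]

/-- `e^{4U} a² A_θ²` at time `τ`, where `R = e^{-τ}`. -/
def spatialTerm (S : ArealCoeffs) (τ θ : ℝ) : ℝ :=
  Real.exp (4 * S.U (Real.exp (-τ)) θ) * S.a (Real.exp (-τ)) θ ^ 2 *
    deriv (fun ϑ => S.A (Real.exp (-τ)) ϑ) θ ^ 2

/-- `a (a⁻¹ U_τ)_τ - ½ e^{2τ} e^{4U} A_τ²`, where `R = e^{-τ}`. -/
def avtdTerm (S : ArealCoeffs) (τ θ : ℝ) : ℝ :=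
  S.a (Real.exp (-τ)) θ *
      deriv (fun s => (S.a (Real.exp (-s)) θ)⁻¹ * deriv (fun r => S.U (Real.exp (-r)) θ) s) τ
    - (1 / 2) * Real.exp (2 * τ) * Real.exp (4 * S.U (Real.exp (-τ)) θ) *
      deriv (fun s => S.A (Real.exp (-s)) θ) τ ^ 2

end ArealCoeffs

/-- The negative Sobolev norm of a function `σ` on the circle `ℝ/ℓℤ` with respect to a positive
weight `a`: the supremum of
`∫ σ φ a⁻¹ dθ / (∫ (φ² + a² φ_θ²) a⁻¹ dθ)^{1/2}` over the nonzero smooth `φ` on `ℝ/ℓℤ`.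
(Passing from `φ` to `-φ` one sees that cutting off negative quotients at `0` is immaterial.) -/
def negSobolevNorm (ℓ : ℝ) (a σ : ℝ → ℝ) : ℝ≥0∞ :=
  ⨆ (φ : ℝ → ℝ) (_ : ContDiff ℝ ∞ φ ∧ Function.Periodic φ ℓ ∧ φ ≠ 0),
    ENNReal.ofReal
      ((∫ θ in (0 : ℝ)..ℓ, σ θ * φ θ * (a θ)⁻¹) /
        Real.sqrt (∫ θ in (0 : ℝ)..ℓ, (φ θ ^ 2 + a θ ^ 2 * deriv φ θ ^ 2) * (a θ)⁻¹))

/-- `∫_{τ₀}^∞ e^{2τ} ‖f(τ)‖² dτ`, where the norm at time `τ` is the negative Sobolev norm with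
weight `a(τ)`; here `a τ θ` is a function of `τ` and `θ`. -/
def weightedNormIntegral (ℓ τ₀ : ℝ) (a f : ℝ → ℝ → ℝ) : ℝ≥0∞ :=
  ∫⁻ τ in Ioi τ₀, ENNReal.ofReal (Real.exp (2 * τ)) * negSobolevNorm ℓ (a τ) (f τ) ^ 2

end

/-!
The spacetime satisfies, in areal coordinates, the evolution equation
`a_R = -½ K² e^{2η} R⁻³ a`, the Hamiltonian constraint, which gives `η_R`, and wave equations for
`U` and `A` (`ArealCoeffs.IsTwistedVacuum.vacuum_equations`). In terms of `τ = -log R` the wave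
equation of `U` reads

  `a (a⁻¹ U_τ)_τ - ½ e^{2τ} e^{4U} A_τ² = e^{-2τ} a (a U_θ)_θ - ½ e^{4U} a² A_θ²`.

The last term is controlled by assumption. The other term on the right is a divergence, so
integration by parts and the Cauchy-Schwarz inequality bound its negative Sobolev norm by
`e^{-2τ} (∫ a U_θ² dθ)^{1/2}` (`negSobolevNorm_le`), and it remains to see that
`∫∫ e^{-2τ} a U_θ² dθ dτ` is finite. This follows from a monotone energy: the integral over the
circle of the positive quantity

  `R² (a⁻¹ U_R² + a U_θ²) + ¼ e^{4U} (a⁻¹ A_R² + a A_θ²) + ¼ K² e^{2η} a⁻¹ R⁻² + a⁻¹`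

has `R`-derivative `∫ (2 R a U_θ² + ½ R⁻¹ e^{4U} a⁻¹ A_R²) dθ` by the vacuum equations
(`ArealCoeffs.IsTwistedVacuum.pd_energyDensity`). Hence it decreases in `τ`, and being nonnegative
it can dissipate only a finite amount as `τ → ∞`.

The vacuum equations are extracted from the coordinate definition of the Ricci tensor as follows.
A linear change of the torus coordinates, under which the Ricci tensor transforms as a bilinear
form (`ric_congruence`), makes the metric diagonal at a given point (`torusMatrix_congruence`). There
the Ricci tensor is an explicit expression in the derivatives of the metric of order at most two
(`ric_eq_ricDiag`), which are listed in `torusJetOne` and `torusJetTwo`.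
-/

/-! ### Partial derivatives of functions on a strip -/

/-- The four coordinate directions of spacetime, projected to the `(R, θ)`-plane. -/
def stripDir : Fin 4 → ℝ × ℝ := ![(1, 0), (0, 1), 0, 0]

/-- The derivative in the `i`-th spacetime coordinate of a function of `(R, θ)` alone; it vanishes
for the two torus coordinates. -/
noncomputable def pd (i : Fin 4) (F : ℝ → ℝ → ℝ) (R θ : ℝ) : ℝ :=
  ![deriv (fun r => F r θ) R, deriv (fun t => F R t) θ, 0, 0] i

/-- Smoothness of a function of `(R, θ)` on the strip `0 < R < R₁`. -/
def SmoothStrip (R₁ : ℝ) (F : ℝ → ℝ → ℝ) : Prop :=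
  ContDiffOn ℝ ∞ (Function.uncurry F) (Ioo 0 R₁ ×ˢ univ)

theorem isOpen_strip (R₁ : ℝ) : IsOpen (Ioo 0 R₁ ×ˢ (univ : Set ℝ)) := isOpen_Ioo.prod isOpen_univ

theorem mem_strip {R₁ R : ℝ} (hR : R ∈ Ioo 0 R₁) (θ : ℝ) :
    ((R, θ) : ℝ × ℝ) ∈ Ioo 0 R₁ ×ˢ (univ : Set ℝ) := ⟨hR, mem_univ _⟩

theorem coordDeriv_eq_pd (i : Fin 4) (F : ℝ → ℝ → ℝ) (p : Fin 4 → ℝ) :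
    coordDeriv i (fun q => F (q 0) (q 1)) p = pd i F (p 0) (p 1) := by
  fin_cases i <;> simp [coordDeriv, pd]

namespace SmoothStrip

variable {R₁ R : ℝ} {F G : ℝ → ℝ → ℝ}

theorem contDiffAt (hF : SmoothStrip R₁ F) (hR : R ∈ Ioo 0 R₁) (θ : ℝ) :
    ContDiffAt ℝ ∞ (Function.uncurry F) (R, θ) :=
  ContDiffOn.contDiffAt hF ((isOpen_strip R₁).mem_nhds (mem_strip hR θ))

theorem differentiableAt (hF : SmoothStrip R₁ F) (hR : R ∈ Ioo 0 R₁) (θ : ℝ) :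
    DifferentiableAt ℝ (Function.uncurry F) (R, θ) :=
  (hF.contDiffAt hR θ).differentiableAt (by simp)

theorem pd_eq_fderiv (hF : SmoothStrip R₁ F) (hR : R ∈ Ioo 0 R₁) (θ : ℝ) (i : Fin 4) :
    pd i F R θ = fderiv ℝ (Function.uncurry F) (R, θ) (stripDir i) := by
  have h := (hF.differentiableAt hR θ).hasFDerivAt
  fin_cases i
  · have h1 : HasDerivAt (fun r : ℝ => (r, θ)) ((1 : ℝ), (0 : ℝ)) R :=
      (hasDerivAt_id R).prodMk (hasDerivAt_const R θ)
    exact (h.comp_hasDerivAt R h1).deriv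
  · have h1 : HasDerivAt (fun t : ℝ => (R, t)) ((0 : ℝ), (1 : ℝ)) θ :=
      (hasDerivAt_const θ R).prodMk (hasDerivAt_id θ)
    exact (h.comp_hasDerivAt θ h1).deriv
  · simp [pd, stripDir]
  · simp [pd, stripDir]

theorem hasDerivAt_fst (hF : SmoothStrip R₁ F) (hR : R ∈ Ioo 0 R₁) (θ : ℝ) :
    HasDerivAt (fun r => F r θ) (pd 0 F R θ) R := by
  have h1 : HasDerivAt (fun r : ℝ => (r, θ)) ((1 : ℝ), (0 : ℝ)) R :=
    (hasDerivAt_id R).prodMk (hasDerivAt_const R θ)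
  exact ((hF.differentiableAt hR θ).hasFDerivAt.comp_hasDerivAt R h1).differentiableAt.hasDerivAt

theorem hasDerivAt_snd (hF : SmoothStrip R₁ F) (hR : R ∈ Ioo 0 R₁) (θ : ℝ) :
    HasDerivAt (fun t => F R t) (pd 1 F R θ) θ := by
  have h1 : HasDerivAt (fun t : ℝ => (R, t)) ((0 : ℝ), (1 : ℝ)) θ :=
    (hasDerivAt_const θ R).prodMk (hasDerivAt_id θ)
  exact ((hF.differentiableAt hR θ).hasFDerivAt.comp_hasDerivAt θ h1).differentiableAt.hasDerivAt

theorem congr (hF : SmoothStrip R₁ F) (h : ∀ R ∈ Ioo 0 R₁, ∀ θ, G R θ = F R θ) :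
    SmoothStrip R₁ G :=
  ContDiffOn.congr hF fun x hx => h x.1 hx.1 x.2

theorem const (c : ℝ) : SmoothStrip R₁ (fun _ _ => c) := contDiffOn_const

theorem add (hF : SmoothStrip R₁ F) (hG : SmoothStrip R₁ G) :
    SmoothStrip R₁ (fun R θ => F R θ + G R θ) := ContDiffOn.add hF hG

theorem sub (hF : SmoothStrip R₁ F) (hG : SmoothStrip R₁ G) :
    SmoothStrip R₁ (fun R θ => F R θ - G R θ) := ContDiffOn.sub hF hG

theorem neg (hF : SmoothStrip R₁ F) : SmoothStrip R₁ (fun R θ => -F R θ) := ContDiffOn.neg hF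

theorem mul (hF : SmoothStrip R₁ F) (hG : SmoothStrip R₁ G) :
    SmoothStrip R₁ (fun R θ => F R θ * G R θ) := ContDiffOn.mul hF hG

theorem exp (hF : SmoothStrip R₁ F) : SmoothStrip R₁ (fun R θ => Real.exp (F R θ)) :=
  ContDiffOn.exp hF

theorem log (hF : SmoothStrip R₁ F) (h0 : ∀ R ∈ Ioo 0 R₁, ∀ θ, F R θ ≠ 0) :
    SmoothStrip R₁ (fun R θ => Real.log (F R θ)) :=
  ContDiffOn.log hF fun x hx => h0 x.1 hx.1 x.2

theorem inv (hF : SmoothStrip R₁ F) (h0 : ∀ R ∈ Ioo 0 R₁, ∀ θ, F R θ ≠ 0) :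
    SmoothStrip R₁ (fun R θ => (F R θ)⁻¹) :=
  ContDiffOn.inv hF fun x hx => h0 x.1 hx.1 x.2

theorem fst : SmoothStrip R₁ (fun R _ => R) := contDiffOn_fst

theorem sum {ι : Type*} (s : Finset ι) {f : ι → ℝ → ℝ → ℝ} (h : ∀ i ∈ s, SmoothStrip R₁ (f i)) :
    SmoothStrip R₁ (fun R θ => ∑ i ∈ s, f i R θ) :=
  ContDiffOn.sum (f := fun i => Function.uncurry (f i)) h

theorem prod {ι : Type*} (s : Finset ι) {f : ι → ℝ → ℝ → ℝ} (h : ∀ i ∈ s, SmoothStrip R₁ (f i)) :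
    SmoothStrip R₁ (fun R θ => ∏ i ∈ s, f i R θ) :=
  contDiffOn_prod (f := fun i => Function.uncurry (f i)) h

theorem pd (hF : SmoothStrip R₁ F) (i : Fin 4) : SmoothStrip R₁ (pd i F) := by
  have h : ContDiffOn ℝ ∞ (fun x => fderiv ℝ (Function.uncurry F) x (stripDir i))
      (Ioo 0 R₁ ×ˢ univ) :=
    (ContDiffOn.fderiv_of_isOpen hF (isOpen_strip R₁) (by simp)).clm_apply contDiffOn_const
  exact ContDiffOn.congr h fun x hx => hF.pd_eq_fderiv hx.1 x.2 i

theorem continuousOn (hF : SmoothStrip R₁ F) :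
    ContinuousOn (Function.uncurry F) (Ioo 0 R₁ ×ˢ univ) :=
  ContDiffOn.continuousOn hF

theorem continuous_snd (hF : SmoothStrip R₁ F) (hR : R ∈ Ioo 0 R₁) : Continuous (F R) :=
  continuous_iff_continuousAt.2 fun θ => (hF.hasDerivAt_snd hR θ).continuousAt

end SmoothStrip

section Rules

variable {R₁ R : ℝ} {F G : ℝ → ℝ → ℝ}

theorem pd_congr (h : ∀ R ∈ Ioo 0 R₁, ∀ θ, F R θ = G R θ) (hR : R ∈ Ioo 0 R₁) (θ : ℝ) (i : Fin 4) :
    pd i F R θ = pd i G R θ := by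
  have h0 : (fun r => F r θ) =ᶠ[nhds R] fun r => G r θ := by
    filter_upwards [isOpen_Ioo.mem_nhds hR] with r hr using h r hr θ
  have h1 : (fun t => F R t) = fun t => G R t := funext (h R hR)
  simp [pd, h0.deriv_eq, h1]

theorem pd_const (c : ℝ) (i : Fin 4) (θ : ℝ) : pd i (fun _ _ => c) R θ = 0 := by
  fin_cases i <;> simp [pd]

theorem pd_add (hF : SmoothStrip R₁ F) (hG : SmoothStrip R₁ G) (hR : R ∈ Ioo 0 R₁) (θ : ℝ)
    (i : Fin 4) : pd i (fun R θ => F R θ + G R θ) R θ = pd i F R θ + pd i G R θ := by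
  rw [(hF.add hG).pd_eq_fderiv hR, hF.pd_eq_fderiv hR, hG.pd_eq_fderiv hR]
  exact congrArg (· (stripDir i)) (fderiv_add (hF.differentiableAt hR θ) (hG.differentiableAt hR θ))

theorem pd_neg (i : Fin 4) (θ : ℝ) : pd i (fun R θ => -F R θ) R θ = -pd i F R θ := by
  fin_cases i <;> simp [pd]

theorem pd_sub (hF : SmoothStrip R₁ F) (hG : SmoothStrip R₁ G) (hR : R ∈ Ioo 0 R₁) (θ : ℝ)
    (i : Fin 4) : pd i (fun R θ => F R θ - G R θ) R θ = pd i F R θ - pd i G R θ := by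
  have := pd_add hF hG.neg hR θ i
  rw [pd_neg] at this
  simpa [sub_eq_add_neg] using this

theorem pd_mul (hF : SmoothStrip R₁ F) (hG : SmoothStrip R₁ G) (hR : R ∈ Ioo 0 R₁) (θ : ℝ)
    (i : Fin 4) :
    pd i (fun R θ => F R θ * G R θ) R θ = pd i F R θ * G R θ + F R θ * pd i G R θ := by
  rw [(hF.mul hG).pd_eq_fderiv hR, hF.pd_eq_fderiv hR, hG.pd_eq_fderiv hR]
  refine (congrArg (· (stripDir i))
    (fderiv_mul (hF.differentiableAt hR θ) (hG.differentiableAt hR θ))).trans ?_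
  simp [Function.uncurry]
  ring

theorem pd_exp (hF : SmoothStrip R₁ F) (hR : R ∈ Ioo 0 R₁) (θ : ℝ) (i : Fin 4) :
    pd i (fun R θ => Real.exp (F R θ)) R θ = Real.exp (F R θ) * pd i F R θ := by
  rw [hF.exp.pd_eq_fderiv hR, hF.pd_eq_fderiv hR]
  exact congrArg (· (stripDir i)) (fderiv_exp (hF.differentiableAt hR θ))

theorem pd_log (hF : SmoothStrip R₁ F) (h0 : ∀ R ∈ Ioo 0 R₁, ∀ θ, F R θ ≠ 0)
    (hR : R ∈ Ioo 0 R₁) (θ : ℝ) (i : Fin 4) :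
    pd i (fun R θ => Real.log (F R θ)) R θ = (F R θ)⁻¹ * pd i F R θ := by
  rw [(hF.log h0).pd_eq_fderiv hR, hF.pd_eq_fderiv hR]
  exact congrArg (· (stripDir i)) ((hF.differentiableAt hR θ).hasFDerivAt.log (h0 R hR θ)).fderiv

theorem pd_const_mul (c : ℝ) (i : Fin 4) (θ : ℝ) :
    pd i (fun R θ => c * F R θ) R θ = c * pd i F R θ := by
  fin_cases i <;> simp [pd]

theorem pd_sum {ι : Type*} (s : Finset ι) {f : ι → ℝ → ℝ → ℝ}
    (h : ∀ i ∈ s, SmoothStrip R₁ (f i)) (hR : R ∈ Ioo 0 R₁) (θ : ℝ) (i : Fin 4) :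
    pd i (fun R θ => ∑ j ∈ s, f j R θ) R θ = ∑ j ∈ s, pd i (f j) R θ := by
  classical
  induction s using Finset.induction_on with
  | empty => simpa using pd_const 0 i θ
  | insert a s ha ih =>
    simp only [Finset.sum_insert ha]
    rw [pd_add (h a (by simp)) (SmoothStrip.sum s fun j hj => h j (by simp [hj])) hR,
      ih fun j hj => h j (by simp [hj])]

theorem pd_pd_add (hF : SmoothStrip R₁ F) (hG : SmoothStrip R₁ G) (hR : R ∈ Ioo 0 R₁) (θ : ℝ)
    (i j : Fin 4) :
    pd i (pd j (fun R θ => F R θ + G R θ)) R θ = pd i (pd j F) R θ + pd i (pd j G) R θ := by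
  rw [pd_congr (fun R hR θ => pd_add hF hG hR θ j) hR, pd_add (hF.pd j) (hG.pd j) hR]

theorem pd_pd_mul (hF : SmoothStrip R₁ F) (hG : SmoothStrip R₁ G) (hR : R ∈ Ioo 0 R₁) (θ : ℝ)
    (i j : Fin 4) :
    pd i (pd j (fun R θ => F R θ * G R θ)) R θ = pd i (pd j F) R θ * G R θ
      + pd j F R θ * pd i G R θ + pd i F R θ * pd j G R θ + F R θ * pd i (pd j G) R θ := by
  rw [pd_congr (fun R hR θ => pd_mul hF hG hR θ j) hR,
    pd_add ((hF.pd j).mul hG) (hF.mul (hG.pd j)) hR, pd_mul (hF.pd j) hG hR,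
    pd_mul hF (hG.pd j) hR]
  ring

theorem pd_pd_exp (hF : SmoothStrip R₁ F) (hR : R ∈ Ioo 0 R₁) (θ : ℝ) (i j : Fin 4) :
    pd i (pd j (fun R θ => Real.exp (F R θ))) R θ
      = Real.exp (F R θ) * (pd i (pd j F) R θ + pd i F R θ * pd j F R θ) := by
  rw [pd_congr (fun R hR θ => pd_exp hF hR θ j) hR, pd_mul hF.exp (hF.pd j) hR, pd_exp hF hR]
  ring

theorem pd_comm (hF : SmoothStrip R₁ F) (hR : R ∈ Ioo 0 R₁) (θ : ℝ) (i j : Fin 4) :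
    pd i (pd j F) R θ = pd j (pd i F) R θ := by
  have key : ∀ i j : Fin 4, pd i (pd j F) R θ
      = fderiv ℝ (fderiv ℝ (Function.uncurry F)) (R, θ) (stripDir i) (stripDir j) := by
    intro i j
    have hd : DifferentiableAt ℝ (fderiv ℝ (Function.uncurry F)) (R, θ) :=
      ((hF.contDiffAt hR θ).fderiv_right (m := 1)
        (WithTop.coe_le_coe.2 le_top : ((1 + 1 : ℕ∞) : WithTop ℕ∞) ≤ ((⊤ : ℕ∞) : WithTop ℕ∞))).differentiableAt
        (by simp)
    rw [(hF.pd j).pd_eq_fderiv hR]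
    have he : Function.uncurry (pd j F) =ᶠ[nhds (R, θ)]
        fun x => fderiv ℝ (Function.uncurry F) x (stripDir j) := by
      filter_upwards [(isOpen_strip R₁).mem_nhds (mem_strip hR θ)] with x hx
      exact hF.pd_eq_fderiv hx.1 x.2 j
    rw [he.fderiv_eq, fderiv_clm_apply hd (differentiableAt_const _)]
    simp
  rw [key, key]
  exact (hF.contDiffAt hR θ).isSymmSndFDerivAt
    (by simpa using (WithTop.coe_le_coe.2 le_top : ((2 : ℕ∞) : WithTop ℕ∞) ≤ ((⊤ : ℕ∞) : WithTop ℕ∞))) _ _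

end Rules

/-! ### The Ricci tensor of a metric depending on two coordinates -/

/-- Christoffel symbols `Γ^k_{ij}` of a metric whose matrix `M` depends on `(R, θ)` only. -/
noncomputable def chr (M : ℝ → ℝ → Matrix (Fin 4) (Fin 4) ℝ) (k i j : Fin 4) (R θ : ℝ) : ℝ :=
  (1 / 2) * ∑ l, (M R θ)⁻¹ k l *
    (pd i (fun r t => M r t j l) R θ + pd j (fun r t => M r t i l) R θ
      - pd l (fun r t => M r t i j) R θ)

/-- The Ricci tensor of a metric whose matrix `M` depends on `(R, θ)` only. -/
noncomputable def ric (M : ℝ → ℝ → Matrix (Fin 4) (Fin 4) ℝ) (i j : Fin 4) (R θ : ℝ) : ℝ :=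
  ∑ k, (pd k (chr M k i j) R θ - pd j (chr M k i k) R θ
    + ∑ l, (chr M k k l R θ * chr M l i j R θ - chr M k j l R θ * chr M l i k R θ))

theorem christoffel_eq_chr (M : ℝ → ℝ → Matrix (Fin 4) (Fin 4) ℝ) (k i j : Fin 4) :
    christoffel (fun q => M (q 0) (q 1)) k i j = fun p => chr M k i j (p 0) (p 1) := by
  funext p
  simp only [christoffel, chr, ← coordDeriv_eq_pd]

theorem ricci_eq_ric (M : ℝ → ℝ → Matrix (Fin 4) (Fin 4) ℝ) (i j : Fin 4) (p : Fin 4 → ℝ) :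
    ricci (fun q => M (q 0) (q 1)) i j p = ric M i j (p 0) (p 1) := by
  simp only [ricci, ric, christoffel_eq_chr, coordDeriv_eq_pd]

/-- The metric with matrix `M`, and its inverse, are smooth on the strip `0 < R < R₁`. -/
structure SmoothMetric (R₁ : ℝ) (M : ℝ → ℝ → Matrix (Fin 4) (Fin 4) ℝ) : Prop where
  entry : ∀ i j, SmoothStrip R₁ fun R θ => M R θ i j
  inv_entry : ∀ i j, SmoothStrip R₁ fun R θ => (M R θ)⁻¹ i j

namespace SmoothMetric

variable {R₁ R : ℝ} {M : ℝ → ℝ → Matrix (Fin 4) (Fin 4) ℝ}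

theorem smoothStrip_lower (hM : SmoothMetric R₁ M) (i j l : Fin 4) :
    SmoothStrip R₁ fun R θ => pd i (fun r t => M r t j l) R θ + pd j (fun r t => M r t i l) R θ
      - pd l (fun r t => M r t i j) R θ :=
  (((hM.entry j l).pd i).add ((hM.entry i l).pd j)).sub ((hM.entry i j).pd l)

theorem smoothStrip_chr (hM : SmoothMetric R₁ M) (k i j : Fin 4) : SmoothStrip R₁ (chr M k i j) :=
  (SmoothStrip.const (1 / 2)).mul
    (SmoothStrip.sum _ fun l _ => (hM.inv_entry k l).mul (hM.smoothStrip_lower i j l))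

end SmoothMetric

/-! ### Covariance under linear changes of the torus coordinates -/

section Covariance

variable {R₁ R : ℝ} {M : ℝ → ℝ → Matrix (Fin 4) (Fin 4) ℝ} {L N : Matrix (Fin 4) (Fin 4) ℝ}

/-- A linear change of coordinates with matrix `L` preserving `R` and `θ` only mixes derivatives in
directions in which functions of `(R, θ)` are constant. -/
theorem pd_eq_sum (h0 : L 0 = ![1, 0, 0, 0]) (h1 : L 1 = ![0, 1, 0, 0]) (i : Fin 4)
    (F : ℝ → ℝ → ℝ) (R θ : ℝ) : pd i F R θ = ∑ b, L b i * pd b F R θ := by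
  rw [Fin.sum_univ_four, h0, h1]
  fin_cases i <;> simp [pd]

theorem pd_mul_mul_entry {X : ℝ → ℝ → Matrix (Fin 4) (Fin 4) ℝ}
    (hX : ∀ i j, SmoothStrip R₁ fun R θ => X R θ i j) (hR : R ∈ Ioo 0 R₁) (θ : ℝ)
    (P Q : Matrix (Fin 4) (Fin 4) ℝ) (a i j : Fin 4) :
    pd a (fun R θ => (P * X R θ * Q) i j) R θ
      = (P * (Matrix.of fun c d => pd a (fun R θ => X R θ c d) R θ) * Q) i j := by
  simp only [Matrix.mul_apply, Finset.sum_mul, Matrix.of_apply]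
  have hs : ∀ x y : Fin 4, SmoothStrip R₁ fun R θ => P i y * X R θ y x * Q x j := fun x y =>
    ((SmoothStrip.const _).mul (hX y x)).mul (SmoothStrip.const _)
  rw [pd_sum (f := fun x R θ => ∑ y, P i y * X R θ y x * Q x j) _
    (fun x _ => SmoothStrip.sum _ fun y _ => hs x y) hR]
  refine Finset.sum_congr rfl fun x _ => ?_
  rw [pd_sum (f := fun y R θ => P i y * X R θ y x * Q x j) _ (fun y _ => hs x y) hR]
  refine Finset.sum_congr rfl fun y _ => ?_
  have : (fun R θ => P i y * X R θ y x * Q x j) = fun R θ => (P i y * Q x j) * X R θ y x := by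
    funext R θ; ring
  rw [this, pd_const_mul]
  ring

/-- The matrix `(Γ_i)^k_j` of the Levi-Civita connection in the direction `i`. -/
noncomputable def chrMatrix (M : ℝ → ℝ → Matrix (Fin 4) (Fin 4) ℝ) (i : Fin 4) (R θ : ℝ) :
    Matrix (Fin 4) (Fin 4) ℝ := Matrix.of fun k j => chr M k i j R θ

/-- The matrix of the coordinate derivatives `∂_a (Γ_i)^k_j` of the connection matrices. -/
noncomputable def pdChrMatrix (M : ℝ → ℝ → Matrix (Fin 4) (Fin 4) ℝ) (a i : Fin 4) (R θ : ℝ) :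
    Matrix (Fin 4) (Fin 4) ℝ := Matrix.of fun k j => pd a (chr M k i j) R θ

/-- The matrix with `(l, j)` entry `2 Γ_{l,ij}` (Christoffel symbols of the first kind). -/
noncomputable def lowerMatrix (M : ℝ → ℝ → Matrix (Fin 4) (Fin 4) ℝ) (i : Fin 4) (R θ : ℝ) :
    Matrix (Fin 4) (Fin 4) ℝ := Matrix.of fun l j =>
  pd i (fun r t => M r t j l) R θ + pd j (fun r t => M r t i l) R θ
      - pd l (fun r t => M r t i j) R θ

theorem chrMatrix_eq (M : ℝ → ℝ → Matrix (Fin 4) (Fin 4) ℝ) (i : Fin 4) (R θ : ℝ) :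
    chrMatrix M i R θ = (1 / 2 : ℝ) • ((M R θ)⁻¹ * lowerMatrix M i R θ) := by
  ext k j
  simp [chrMatrix, chr, lowerMatrix, Matrix.mul_apply]

theorem ric_eq_matrix (M : ℝ → ℝ → Matrix (Fin 4) (Fin 4) ℝ) (i j : Fin 4) (R θ : ℝ) :
    ric M i j R θ = ∑ k, pdChrMatrix M k i R θ k j - (pdChrMatrix M j i R θ).trace
      + (∑ k, (chrMatrix M k R θ * chrMatrix M i R θ) k j
        - (chrMatrix M j R θ * chrMatrix M i R θ).trace) := by
  simp only [ric, Finset.sum_add_distrib, Finset.sum_sub_distrib, pdChrMatrix, chrMatrix,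
    Matrix.trace, Matrix.diag, Matrix.mul_apply, Matrix.of_apply]

theorem pd_congruence_entry (h0 : L 0 = ![1, 0, 0, 0]) (h1 : L 1 = ![0, 1, 0, 0])
    (hM : SmoothMetric R₁ M) (hR : R ∈ Ioo 0 R₁) (θ : ℝ) (i j l : Fin 4) :
    pd i (fun R θ => (Lᵀ * M R θ * L) j l) R θ
      = ∑ b, ∑ c, ∑ d, L b i * L c j * L d l * pd b (fun R θ => M R θ c d) R θ := by
  rw [pd_eq_sum h0 h1]
  refine Finset.sum_congr rfl fun b _ => ?_
  rw [pd_mul_mul_entry hM.entry hR]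
  simp only [Matrix.mul_apply, Finset.sum_mul, Finset.mul_sum, Matrix.of_apply,
    Matrix.transpose_apply]
  rw [Finset.sum_comm]
  refine Finset.sum_congr rfl fun c _ => Finset.sum_congr rfl fun d _ => ?_
  ring

theorem lowerMatrix_congruence (h0 : L 0 = ![1, 0, 0, 0]) (h1 : L 1 = ![0, 1, 0, 0])
    (hM : SmoothMetric R₁ M) (hR : R ∈ Ioo 0 R₁) (θ : ℝ) (i : Fin 4) :
    lowerMatrix (fun R θ => Lᵀ * M R θ * L) i R θ
      = Lᵀ * (∑ b, L b i • lowerMatrix M b R θ) * L := by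
  ext l j
  have hr : (Lᵀ * (∑ b, L b i • lowerMatrix M b R θ) * L) l j
      = ∑ b, ∑ c, ∑ d, L b i * L c j * L d l * lowerMatrix M b R θ d c := by
    simp only [Matrix.mul_apply, Matrix.sum_apply, Matrix.smul_apply, Finset.sum_mul,
      Finset.mul_sum, Matrix.transpose_apply, smul_eq_mul]
    rw [Finset.sum_comm]
    refine Finset.sum_congr rfl fun b _ => Finset.sum_congr rfl fun c _ =>
      Finset.sum_congr rfl fun d _ => ?_
    ring
  rw [hr]
  simp only [lowerMatrix, Matrix.of_apply, pd_congruence_entry h0 h1 hM hR, mul_add, mul_sub,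
    Finset.sum_add_distrib, Finset.sum_sub_distrib]
  congr 1
  · congr 1
    rw [Finset.sum_comm]
    refine Finset.sum_congr rfl fun b _ => Finset.sum_congr rfl fun c _ =>
      Finset.sum_congr rfl fun d _ => ?_
    ring
  · rw [Finset.sum_comm, Finset.sum_congr rfl fun b _ => Finset.sum_comm]
    refine Finset.sum_congr rfl fun b _ => ?_
    refine Finset.sum_congr rfl fun c _ => Finset.sum_congr rfl fun d _ => ?_
    ring

theorem chrMatrix_congruence (h0 : L 0 = ![1, 0, 0, 0]) (h1 : L 1 = ![0, 1, 0, 0])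
    (hLN : L * N = 1) (hM : SmoothMetric R₁ M) (hR : R ∈ Ioo 0 R₁) (θ : ℝ) (i : Fin 4) :
    chrMatrix (fun R θ => Lᵀ * M R θ * L) i R θ
      = N * (∑ b, L b i • chrMatrix M b R θ) * L := by
  have hNL : N * L = 1 := mul_eq_one_comm.1 hLN
  have hL : L⁻¹ = N := Matrix.inv_eq_right_inv hLN
  have hLt : (Lᵀ)⁻¹ = Nᵀ := by rw [← Matrix.transpose_nonsing_inv, hL]
  have hc : Nᵀ * Lᵀ = 1 := by rw [← Matrix.transpose_mul, hLN, Matrix.transpose_one]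
  have hsum : ∑ b, L b i • chrMatrix M b R θ
      = (1 / 2 : ℝ) • ((M R θ)⁻¹ * ∑ b, L b i • lowerMatrix M b R θ) := by
    rw [Finset.mul_sum, Finset.smul_sum]
    refine Finset.sum_congr rfl fun b _ => ?_
    rw [chrMatrix_eq, Matrix.mul_smul, smul_comm]
  rw [chrMatrix_eq, lowerMatrix_congruence h0 h1 hM hR, hsum, Matrix.mul_inv_rev,
    Matrix.mul_inv_rev, hL, hLt, Matrix.mul_smul, Matrix.smul_mul]
  congr 1
  simp only [Matrix.mul_assoc]
  rw [← Matrix.mul_assoc Nᵀ, hc, Matrix.one_mul]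

theorem pdChrMatrix_congruence (h0 : L 0 = ![1, 0, 0, 0]) (h1 : L 1 = ![0, 1, 0, 0])
    (hLN : L * N = 1) (hM : SmoothMetric R₁ M) (hR : R ∈ Ioo 0 R₁) (θ : ℝ) (a i : Fin 4) :
    pdChrMatrix (fun R θ => Lᵀ * M R θ * L) a i R θ
      = N * (∑ c, L c a • ∑ b, L b i • pdChrMatrix M c b R θ) * L := by
  ext k j
  have hS : ∀ k j, SmoothStrip R₁ fun R θ => (∑ b, L b i • chrMatrix M b R θ) k j := by
    intro k j
    simp only [Matrix.sum_apply, Matrix.smul_apply, chrMatrix, Matrix.of_apply, smul_eq_mul]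
    exact SmoothStrip.sum (f := fun b R θ => L b i * chr M k b j R θ) _
      fun b _ => (SmoothStrip.const _).mul (hM.smoothStrip_chr k b j)
  have hc : ∀ R ∈ Ioo 0 R₁, ∀ θ, chr (fun R θ => Lᵀ * M R θ * L) k i j R θ
      = (N * (∑ b, L b i • chrMatrix M b R θ) * L) k j := fun R hR θ =>
    congrFun (congrFun (chrMatrix_congruence h0 h1 hLN hM hR θ i) k) j
  have hp : (Matrix.of fun c d => pd a (fun R θ => (∑ b, L b i • chrMatrix M b R θ) c d) R θ)
      = ∑ c, L c a • ∑ b, L b i • pdChrMatrix M c b R θ := by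
    ext k j
    simp only [Matrix.sum_apply, Matrix.smul_apply, chrMatrix, pdChrMatrix, Matrix.of_apply,
      smul_eq_mul]
    rw [pd_eq_sum h0 h1]
    refine Finset.sum_congr rfl fun c _ => ?_
    rw [pd_sum (f := fun b R θ => L b i * chr M k b j R θ) _
      (fun b _ => (SmoothStrip.const _).mul (hM.smoothStrip_chr k b j)) hR]
    simp only [pd_const_mul]
  rw [← hp, ← pd_mul_mul_entry hS hR]
  exact pd_congr hc hR θ a

theorem sum_conj_diag (hLN : L * N = 1) (Y : Fin 4 → Matrix (Fin 4) (Fin 4) ℝ) (j : Fin 4) :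
    ∑ k, (N * (∑ c, L c k • Y c) * L) k j = ∑ d, L d j * ∑ c, Y c c d := by
  have h : ∀ k, (N * (∑ c, L c k • Y c) * L) k j = ∑ c, L c k * (N * (Y c * L)) k j := by
    intro k
    rw [Matrix.mul_assoc, Finset.sum_mul, Finset.mul_sum, Matrix.sum_apply]
    simp
  simp only [h]
  rw [Finset.sum_comm]
  have h2 : ∀ c, ∑ k, L c k * (N * (Y c * L)) k j = (Y c * L) c j := by
    intro c
    rw [← Matrix.mul_apply, ← Matrix.mul_assoc, hLN, Matrix.one_mul]
  simp only [h2]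
  simp only [Matrix.mul_apply, Finset.mul_sum]
  rw [Finset.sum_comm]
  simp only [mul_comm]

theorem trace_conj (hLN : L * N = 1) (Z : Matrix (Fin 4) (Fin 4) ℝ) :
    (N * Z * L).trace = Z.trace := by
  rw [Matrix.trace_mul_comm, ← Matrix.mul_assoc, hLN, Matrix.one_mul]

/-- The Ricci tensor transforms as a bilinear form under a linear change of coordinates that
preserves `R` and `θ`. -/
theorem ric_congruence (h0 : L 0 = ![1, 0, 0, 0]) (h1 : L 1 = ![0, 1, 0, 0])
    (hLN : L * N = 1) (hM : SmoothMetric R₁ M) (hR : R ∈ Ioo 0 R₁) (θ : ℝ) (i j : Fin 4) :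
    ric (fun R θ => Lᵀ * M R θ * L) i j R θ = ∑ d, L d j * ∑ b, L b i * ric M b d R θ := by
  have hprod : ∀ k, chrMatrix (fun R θ => Lᵀ * M R θ * L) k R θ
        * chrMatrix (fun R θ => Lᵀ * M R θ * L) i R θ
      = N * (∑ c, L c k • (chrMatrix M c R θ * ∑ b, L b i • chrMatrix M b R θ)) * L := by
    intro k
    rw [chrMatrix_congruence h0 h1 hLN hM hR, chrMatrix_congruence h0 h1 hLN hM hR]
    simp only [← Matrix.smul_mul]
    rw [← Finset.sum_mul]
    simp only [Matrix.mul_assoc]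
    rw [← Matrix.mul_assoc L N, hLN, Matrix.one_mul]
  rw [ric_eq_matrix]
  simp only [hprod, pdChrMatrix_congruence h0 h1 hLN hM hR, sum_conj_diag hLN, trace_conj hLN]
  simp only [Matrix.trace_sum, Matrix.trace_smul, smul_eq_mul, ← Finset.sum_sub_distrib,
    ← Finset.sum_add_distrib, ← mul_sub, ← mul_add]
  refine Finset.sum_congr rfl fun d _ => ?_
  congr 1
  simp only [ric_eq_matrix, Matrix.sum_apply, Matrix.smul_apply, smul_eq_mul, Finset.mul_sum,
    Matrix.trace_sum, Matrix.mul_smul, Matrix.trace_smul, mul_add, mul_sub, Finset.sum_add_distrib,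
    Finset.sum_sub_distrib]
  congr 1
  · congr 1
    exact Finset.sum_comm
  · congr 1
    exact Finset.sum_comm

end Covariance

/-! ### The Ricci tensor at a point where the metric is diagonal -/

/-- `2 Γ_{l,ij}` in terms of the first derivatives `D i j l = ∂_i g_{jl}` of the metric. -/
def lowerChr (D : Fin 4 → Fin 4 → Fin 4 → ℝ) (i j l : Fin 4) : ℝ := D i j l + D j i l - D l i j

/-- The Ricci tensor at a point where the inverse metric is the diagonal matrix with entries `e`,
in terms of the first and second derivatives `D i j l = ∂_i g_{jl}` and
`DD m i j l = ∂_m ∂_i g_{jl}` of the metric. -/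
noncomputable def ricDiag (e : Fin 4 → ℝ) (D : Fin 4 → Fin 4 → Fin 4 → ℝ)
    (DD : Fin 4 → Fin 4 → Fin 4 → Fin 4 → ℝ) (i j : Fin 4) : ℝ :=
  ∑ k, ((1 / 2) * (e k * lowerChr (DD k) i j k - ∑ l, e k * D k k l * e l * lowerChr D i j l)
    - (1 / 2) * (e k * (DD j i k k + DD j k i k - DD j k i k)
      - ∑ l, e k * D j k l * e l * lowerChr D i k l)
    + ∑ l, (1 / 4) * e k * e l * (lowerChr D k l k * lowerChr D i j l
      - lowerChr D j l k * lowerChr D i k l))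

section Diagonal

variable {R₁ R : ℝ} {M : ℝ → ℝ → Matrix (Fin 4) (Fin 4) ℝ}

/-- The derivative of the inverse matrix, `∂(g⁻¹) = -g⁻¹ (∂g) g⁻¹`, where `g⁻¹` is diagonal. -/
theorem pd_inv_entry (hM : SmoothMetric R₁ M) (hdet : ∀ R ∈ Ioo 0 R₁, ∀ θ, IsUnit (M R θ).det)
    (hR : R ∈ Ioo 0 R₁) (θ : ℝ) {e : Fin 4 → ℝ} (he : (M R θ)⁻¹ = Matrix.diagonal e)
    (a k l : Fin 4) :
    pd a (fun R θ => (M R θ)⁻¹ k l) R θ = -(e k * pd a (fun R θ => M R θ k l) R θ * e l) := by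
  set X : Matrix (Fin 4) (Fin 4) ℝ := Matrix.of fun k l => pd a (fun R θ => (M R θ)⁻¹ k l) R θ
  set Y : Matrix (Fin 4) (Fin 4) ℝ := Matrix.of fun k l => pd a (fun R θ => M R θ k l) R θ
  have h : X * M R θ + (M R θ)⁻¹ * Y = 0 := by
    ext i j
    have h1 : pd a (fun R θ => ∑ x, (M R θ)⁻¹ i x * M R θ x j) R θ = 0 := by
      rw [pd_congr (G := fun _ _ => (1 : Matrix (Fin 4) (Fin 4) ℝ) i j) _ hR, pd_const]
      intro R hR θ
      rw [← Matrix.mul_apply, Matrix.nonsing_inv_mul _ (hdet R hR θ)]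
    rw [pd_sum (f := fun x R θ => (M R θ)⁻¹ i x * M R θ x j) _
      (fun x _ => (hM.inv_entry i x).mul (hM.entry x j)) hR] at h1
    simp only [fun x => pd_mul (hM.inv_entry i x) (hM.entry x j) hR θ a,
      Finset.sum_add_distrib] at h1
    simpa [Matrix.mul_apply, X, Y] using h1
  have h2 : X = -((M R θ)⁻¹ * Y * (M R θ)⁻¹) := by
    have := congrArg (· * (M R θ)⁻¹) h
    simp only [add_mul, zero_mul, Matrix.mul_nonsing_inv_cancel_right _ _ (hdet R hR θ)] at this
    exact eq_neg_of_add_eq_zero_left this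
  have h3 := congrFun (congrFun h2 k) l
  rw [he] at h3
  simpa [X, Y, Matrix.diagonal_mul, Matrix.mul_diagonal] using h3

theorem ric_eq_ricDiag (hM : SmoothMetric R₁ M)
    (hdet : ∀ R ∈ Ioo 0 R₁, ∀ θ, IsUnit (M R θ).det)
    (hR : R ∈ Ioo 0 R₁) (θ : ℝ) {e : Fin 4 → ℝ} (he : (M R θ)⁻¹ = Matrix.diagonal e)
    (i j : Fin 4) :
    ric M i j R θ = ricDiag e (fun i j l => pd i (fun R θ => M R θ j l) R θ)
      (fun m i j l => pd m (pd i (fun R θ => M R θ j l)) R θ) i j := by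
  have hchr : ∀ k i j, chr M k i j R θ
      = (1 / 2) * (e k * lowerChr (fun i j l => pd i (fun R θ => M R θ j l) R θ) i j k) := by
    intro k i j
    simp [chr, he, Matrix.diagonal_apply, lowerChr]
  have hpd : ∀ m k i j, pd m (chr M k i j) R θ
      = (1 / 2) * (e k * lowerChr (fun i j l => pd m (pd i (fun R θ => M R θ j l)) R θ) i j k
        - ∑ l, e k * pd m (fun R θ => M R θ k l) R θ * e l
          * lowerChr (fun i j l => pd i (fun R θ => M R θ j l) R θ) i j l) := by
    intro m k i j
    have h0 : chr M k i j = fun R θ => (1 / 2) * ∑ l, (M R θ)⁻¹ k l *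
      (pd i (fun r t => M r t j l) R θ + pd j (fun r t => M r t i l) R θ
        - pd l (fun r t => M r t i j) R θ) := rfl
    rw [h0, pd_const_mul, pd_sum (f := fun l R θ => (M R θ)⁻¹ k l *
      (pd i (fun r t => M r t j l) R θ + pd j (fun r t => M r t i l) R θ
        - pd l (fun r t => M r t i j) R θ)) _
      (fun l _ => (hM.inv_entry k l).mul (hM.smoothStrip_lower i j l)) hR]
    congr 1
    have h1 : ∀ l, pd m (fun R θ => (M R θ)⁻¹ k l *
        (pd i (fun r t => M r t j l) R θ + pd j (fun r t => M r t i l) R θ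
        - pd l (fun r t => M r t i j) R θ)) R θ
        = -(e k * pd m (fun R θ => M R θ k l) R θ * e l
          * lowerChr (fun i j l => pd i (fun R θ => M R θ j l) R θ) i j l)
        + Matrix.diagonal e k l
          * lowerChr (fun i j l => pd m (pd i (fun R θ => M R θ j l)) R θ) i j l := by
      intro l
      rw [pd_mul (hM.inv_entry k l) (hM.smoothStrip_lower i j l) hR,
        pd_inv_entry hM hdet hR θ he, he,
        pd_sub (((hM.entry j l).pd i).add ((hM.entry i l).pd j)) ((hM.entry i j).pd l) hR,
        pd_add ((hM.entry j l).pd i) ((hM.entry i l).pd j) hR]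
      simp only [lowerChr]
      ring
    simp only [h1, Finset.sum_add_distrib, Finset.sum_neg_distrib, Matrix.diagonal_apply, ite_mul,
      zero_mul, Finset.sum_ite_eq, Finset.mem_univ, if_true]
    ring
  simp only [ric, hchr, hpd, ricDiag]
  refine Finset.sum_congr rfl fun k _ => ?_
  congr 1
  refine Finset.sum_congr rfl fun l _ => ?_
  simp only [lowerChr]
  ring

end Diagonal

/-! ### The Ricci tensor of a torus-symmetric metric -/

/-- The matrix of the metric
`-e^{2ν} dR² + e^{2β} dθ² + e^{2U} (dx¹ + A dx² + (G + A H) dθ)² + e^{2V} (dx² + H dθ)²`. -/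
noncomputable def torusMatrix (ν β U V A G H : ℝ → ℝ → ℝ) (R θ : ℝ) : Matrix (Fin 4) (Fin 4) ℝ :=
  let n := Real.exp (2 * ν R θ)
  let b := Real.exp (2 * β R θ)
  let u := Real.exp (2 * U R θ)
  let v := Real.exp (2 * V R θ)
  let w := G R θ + A R θ * H R θ
  !![-n, 0, 0, 0;
     0, b + (u * (w * w) + v * (H R θ * H R θ)), u * w, u * (A R θ * w) + v * H R θ;
     0, u * w, u, u * A R θ;
     0, u * (A R θ * w) + v * H R θ, u * A R θ, u * (A R θ * A R θ) + v]

section Torus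

variable {R₁ R : ℝ} {ν β U V A G H : ℝ → ℝ → ℝ}

theorem pd_exp_two_mul {F : ℝ → ℝ → ℝ} (hF : SmoothStrip R₁ F) (hR : R ∈ Ioo 0 R₁) (θ : ℝ)
    (i : Fin 4) :
    pd i (fun R θ => Real.exp (2 * F R θ)) R θ = 2 * Real.exp (2 * F R θ) * pd i F R θ := by
  rw [pd_exp ((SmoothStrip.const 2).mul hF) hR, pd_const_mul]
  ring

theorem pd_pd_exp_two_mul {F : ℝ → ℝ → ℝ} (hF : SmoothStrip R₁ F) (hR : R ∈ Ioo 0 R₁) (θ : ℝ)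
    (i j : Fin 4) :
    pd i (pd j (fun R θ => Real.exp (2 * F R θ))) R θ
      = Real.exp (2 * F R θ) * (2 * pd i (pd j F) R θ + 4 * pd i F R θ * pd j F R θ) := by
  have h : pd j (fun R θ => 2 * F R θ) = fun R θ => 2 * pd j F R θ := by
    funext R θ; exact pd_const_mul _ _ _
  rw [pd_pd_exp ((SmoothStrip.const 2).mul hF) hR, h, pd_const_mul, pd_const_mul]
  beta_reduce
  ring

theorem SmoothStrip.exp_two_mul {F : ℝ → ℝ → ℝ} (hF : SmoothStrip R₁ F) :
    SmoothStrip R₁ (fun R θ => Real.exp (2 * F R θ)) := ((SmoothStrip.const 2).mul hF).exp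

/-- First derivatives of the coefficients of `torusMatrix` where `A = G = H = 0`, in terms of the
first derivatives of the functions it is made of. -/
def torusJetOne (n b u v : ℝ) (ν β U V A G H : Fin 4 → ℝ) (i : Fin 4) :
    Matrix (Fin 4) (Fin 4) ℝ :=
  !![-(2 * n * ν i), 0, 0, 0;
     0, 2 * b * β i, u * G i, v * H i;
     0, u * G i, 2 * u * U i, u * A i;
     0, v * H i, u * A i, 2 * v * V i]

/-- Second derivatives of the coefficients of `torusMatrix` where `A = G = H = 0`, in terms of the
first and second derivatives of the functions it is made of. -/
def torusJetTwo (n b u v : ℝ) (ν β U V A G H : Fin 4 → ℝ) (ν₂ β₂ U₂ V₂ A₂ G₂ H₂ : Fin 4 → Fin 4 → ℝ)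
    (i j : Fin 4) : Matrix (Fin 4) (Fin 4) ℝ :=
  let g12 := u * (G₂ i j + 2 * U i * G j + 2 * U j * G i + A i * H j + A j * H i)
  let g13 := u * (A i * G j + A j * G i) + v * (H₂ i j + 2 * V i * H j + 2 * V j * H i)
  let g23 := u * (A₂ i j + 2 * U i * A j + 2 * U j * A i)
  !![-(n * (2 * ν₂ i j + 4 * ν i * ν j)), 0, 0, 0;
     0, b * (2 * β₂ i j + 4 * β i * β j) + 2 * u * G i * G j + 2 * v * H i * H j, g12, g13;
     0, g12, u * (2 * U₂ i j + 4 * U i * U j), g23;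
     0, g13, g23, v * (2 * V₂ i j + 4 * V i * V j) + 2 * u * A i * A j]

theorem pd_torusMatrix (hν : SmoothStrip R₁ ν) (hβ : SmoothStrip R₁ β) (hU : SmoothStrip R₁ U)
    (hV : SmoothStrip R₁ V) (hA : SmoothStrip R₁ A) (hG : SmoothStrip R₁ G)
    (hH : SmoothStrip R₁ H) (hR : R ∈ Ioo 0 R₁) {θ : ℝ} (hA0 : A R θ = 0) (hG0 : G R θ = 0)
    (hH0 : H R θ = 0) (i j l : Fin 4) :
    pd i (fun R θ => torusMatrix ν β U V A G H R θ j l) R θ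
      = torusJetOne (Real.exp (2 * ν R θ)) (Real.exp (2 * β R θ)) (Real.exp (2 * U R θ))
        (Real.exp (2 * V R θ)) (fun i => pd i ν R θ) (fun i => pd i β R θ) (fun i => pd i U R θ)
        (fun i => pd i V R θ) (fun i => pd i A R θ) (fun i => pd i G R θ) (fun i => pd i H R θ)
        i j l := by
  have en := hν.exp_two_mul
  have eb := hβ.exp_two_mul
  have eu := hU.exp_two_mul
  have ev := hV.exp_two_mul
  have hw := hG.add (hA.mul hH)
  have dw : pd i (fun R θ => G R θ + A R θ * H R θ) R θ = pd i G R θ := by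
    rw [pd_add hG (hA.mul hH) hR, pd_mul hA hH hR, hA0, hH0]; ring
  have hw0 : G R θ + A R θ * H R θ = 0 := by rw [hG0, hA0]; ring
  have h12 : pd i (fun R θ => Real.exp (2 * U R θ) * (G R θ + A R θ * H R θ)) R θ
      = Real.exp (2 * U R θ) * pd i G R θ := by
    rw [pd_mul eu hw hR, dw, hw0]; ring
  have h13 : pd i (fun R θ => Real.exp (2 * U R θ) * (A R θ * (G R θ + A R θ * H R θ))
      + Real.exp (2 * V R θ) * H R θ) R θ = Real.exp (2 * V R θ) * pd i H R θ := by
    rw [pd_add (eu.mul (hA.mul hw)) (ev.mul hH) hR, pd_mul eu (hA.mul hw) hR, pd_mul hA hw hR,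
      pd_mul ev hH hR, dw, hw0, hA0, hH0]
    ring
  have h23 : pd i (fun R θ => Real.exp (2 * U R θ) * A R θ) R θ
      = Real.exp (2 * U R θ) * pd i A R θ := by
    rw [pd_mul eu hA hR, hA0]; ring
  have h11 : pd i (fun R θ => Real.exp (2 * β R θ) + (Real.exp (2 * U R θ) *
      ((G R θ + A R θ * H R θ) * (G R θ + A R θ * H R θ)) + Real.exp (2 * V R θ)
        * (H R θ * H R θ))) R θ = 2 * Real.exp (2 * β R θ) * pd i β R θ := by
    rw [pd_add eb ((eu.mul (hw.mul hw)).add (ev.mul (hH.mul hH))) hR,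
      pd_add (eu.mul (hw.mul hw)) (ev.mul (hH.mul hH)) hR, pd_mul eu (hw.mul hw) hR,
      pd_mul hw hw hR, pd_mul ev (hH.mul hH) hR, pd_mul hH hH hR, pd_exp_two_mul hβ hR, hw0, hH0]
    ring
  have h33 : pd i (fun R θ => Real.exp (2 * U R θ) * (A R θ * A R θ) + Real.exp (2 * V R θ)) R θ
      = 2 * Real.exp (2 * V R θ) * pd i V R θ := by
    rw [pd_add (eu.mul (hA.mul hA)) ev hR, pd_mul eu (hA.mul hA) hR, pd_mul hA hA hR,
      pd_exp_two_mul hV hR, hA0]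
    ring
  have h00 : pd i (fun R θ => -Real.exp (2 * ν R θ)) R θ
      = -(2 * Real.exp (2 * ν R θ) * pd i ν R θ) := by
    rw [pd_neg, pd_exp_two_mul hν hR]
  have hz : pd i (fun _ _ => (0 : ℝ)) R θ = 0 := pd_const _ _ _
  fin_cases j <;> fin_cases l <;>
    simp [torusMatrix, torusJetOne, h00, h11, h12, h13, h23, h33, hz, pd_exp_two_mul hU hR]

theorem pd_pd_torusMatrix (hν : SmoothStrip R₁ ν) (hβ : SmoothStrip R₁ β) (hU : SmoothStrip R₁ U)
    (hV : SmoothStrip R₁ V) (hA : SmoothStrip R₁ A) (hG : SmoothStrip R₁ G)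
    (hH : SmoothStrip R₁ H) (hR : R ∈ Ioo 0 R₁) {θ : ℝ} (hA0 : A R θ = 0) (hG0 : G R θ = 0)
    (hH0 : H R θ = 0) (i j l m : Fin 4) :
    pd i (pd j (fun R θ => torusMatrix ν β U V A G H R θ l m)) R θ
      = torusJetTwo (Real.exp (2 * ν R θ)) (Real.exp (2 * β R θ)) (Real.exp (2 * U R θ))
        (Real.exp (2 * V R θ)) (fun i => pd i ν R θ) (fun i => pd i β R θ) (fun i => pd i U R θ)
        (fun i => pd i V R θ) (fun i => pd i A R θ) (fun i => pd i G R θ) (fun i => pd i H R θ)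
        (fun i j => pd i (pd j ν) R θ) (fun i j => pd i (pd j β) R θ) (fun i j => pd i (pd j U) R θ)
        (fun i j => pd i (pd j V) R θ) (fun i j => pd i (pd j A) R θ) (fun i j => pd i (pd j G) R θ)
        (fun i j => pd i (pd j H) R θ) i j l m := by
  have en := hν.exp_two_mul
  have eb := hβ.exp_two_mul
  have eu := hU.exp_two_mul
  have ev := hV.exp_two_mul
  have hw := hG.add (hA.mul hH)
  have dw : ∀ i, pd i (fun R θ => G R θ + A R θ * H R θ) R θ = pd i G R θ := by
    intro i
    rw [pd_add hG (hA.mul hH) hR, pd_mul hA hH hR, hA0, hH0]; ring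
  have ddw : pd i (pd j (fun R θ => G R θ + A R θ * H R θ)) R θ = pd i (pd j G) R θ
      + pd j A R θ * pd i H R θ + pd i A R θ * pd j H R θ := by
    rw [pd_pd_add hG (hA.mul hH) hR, pd_pd_mul hA hH hR, hA0, hH0]; ring
  have hw0 : G R θ + A R θ * H R θ = 0 := by rw [hG0, hA0]; ring
  have h12 : pd i (pd j (fun R θ => Real.exp (2 * U R θ) * (G R θ + A R θ * H R θ))) R θ
      = Real.exp (2 * U R θ) * (pd i (pd j G) R θ + 2 * pd i U R θ * pd j G R θ
        + 2 * pd j U R θ * pd i G R θ + pd i A R θ * pd j H R θ + pd j A R θ * pd i H R θ) := by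
    rw [pd_pd_mul eu hw hR, dw, dw, ddw, hw0, pd_exp_two_mul hU hR, pd_exp_two_mul hU hR]; ring
  have h13 : pd i (pd j (fun R θ => Real.exp (2 * U R θ) * (A R θ * (G R θ + A R θ * H R θ))
      + Real.exp (2 * V R θ) * H R θ)) R θ
      = Real.exp (2 * U R θ) * (pd i A R θ * pd j G R θ + pd j A R θ * pd i G R θ)
        + Real.exp (2 * V R θ) * (pd i (pd j H) R θ + 2 * pd i V R θ * pd j H R θ
          + 2 * pd j V R θ * pd i H R θ) := by
    rw [pd_pd_add (eu.mul (hA.mul hw)) (ev.mul hH) hR, pd_pd_mul eu (hA.mul hw) hR,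
      pd_pd_mul hA hw hR, pd_mul hA hw hR, pd_mul hA hw hR, pd_pd_mul ev hH hR,
      dw, dw, hw0, hA0, hH0, pd_exp_two_mul hV hR, pd_exp_two_mul hV hR]
    ring
  have h23 : pd i (pd j (fun R θ => Real.exp (2 * U R θ) * A R θ)) R θ
      = Real.exp (2 * U R θ) * (pd i (pd j A) R θ + 2 * pd i U R θ * pd j A R θ
        + 2 * pd j U R θ * pd i A R θ) := by
    rw [pd_pd_mul eu hA hR, hA0, pd_exp_two_mul hU hR, pd_exp_two_mul hU hR]; ring
  have h11 : pd i (pd j (fun R θ => Real.exp (2 * β R θ) + (Real.exp (2 * U R θ) *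
      ((G R θ + A R θ * H R θ) * (G R θ + A R θ * H R θ)) + Real.exp (2 * V R θ)
        * (H R θ * H R θ)))) R θ
      = Real.exp (2 * β R θ) * (2 * pd i (pd j β) R θ + 4 * pd i β R θ * pd j β R θ)
        + 2 * Real.exp (2 * U R θ) * pd i G R θ * pd j G R θ
        + 2 * Real.exp (2 * V R θ) * pd i H R θ * pd j H R θ := by
    rw [pd_pd_add eb ((eu.mul (hw.mul hw)).add (ev.mul (hH.mul hH))) hR,
      pd_pd_add (eu.mul (hw.mul hw)) (ev.mul (hH.mul hH)) hR, pd_pd_mul eu (hw.mul hw) hR,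
      pd_pd_mul hw hw hR, pd_mul hw hw hR, pd_mul hw hw hR, pd_pd_mul ev (hH.mul hH) hR,
      pd_pd_mul hH hH hR, pd_mul hH hH hR, pd_mul hH hH hR, pd_pd_exp_two_mul hβ hR, dw, dw,
      hw0, hH0]
    ring
  have h33 : pd i (pd j (fun R θ => Real.exp (2 * U R θ) * (A R θ * A R θ)
        + Real.exp (2 * V R θ))) R θ
      = Real.exp (2 * V R θ) * (2 * pd i (pd j V) R θ + 4 * pd i V R θ * pd j V R θ)
        + 2 * Real.exp (2 * U R θ) * pd i A R θ * pd j A R θ := by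
    rw [pd_pd_add (eu.mul (hA.mul hA)) ev hR, pd_pd_mul eu (hA.mul hA) hR, pd_pd_mul hA hA hR,
      pd_mul hA hA hR, pd_mul hA hA hR, pd_pd_exp_two_mul hV hR, hA0]
    ring
  have h00 : pd i (pd j (fun R θ => -Real.exp (2 * ν R θ))) R θ
      = -(Real.exp (2 * ν R θ) * (2 * pd i (pd j ν) R θ + 4 * pd i ν R θ * pd j ν R θ)) := by
    rw [show pd j (fun R θ => -Real.exp (2 * ν R θ))
      = fun R θ => -pd j (fun R θ => Real.exp (2 * ν R θ)) R θ by
        funext R θ; exact pd_neg _ _, pd_neg, pd_pd_exp_two_mul hν hR]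
  have hz : pd i (pd j (fun _ _ => (0 : ℝ))) R θ = 0 := by
    rw [show pd j (fun _ _ => (0 : ℝ)) = fun _ _ => 0 by funext R θ; exact pd_const _ _ _, pd_const]
  fin_cases l <;> fin_cases m <;>
    simp [torusMatrix, torusJetTwo, h00, h11, h12, h13, h23, h33, hz, pd_pd_exp_two_mul hU hR]

end Torus

theorem pd_two (F : ℝ → ℝ → ℝ) : pd 2 F = fun _ _ => 0 := by
  funext R θ; simp [pd]

theorem pd_three (F : ℝ → ℝ → ℝ) : pd 3 F = fun _ _ => 0 := by
  funext R θ; simp [pd]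

theorem pd_zero_fun (i : Fin 4) : pd i (fun _ _ => (0 : ℝ)) = fun _ _ => 0 := by
  funext R θ; exact pd_const _ _ _

section TorusRicci

variable (n b u v : ℝ) (ν β U V A G H : ℝ → ℝ → ℝ) (R θ : ℝ)

/-- The Ricci tensor of `torusMatrix` at a point where `A = G = H = 0`, with `n, b, u, v` the values
of `e^{2ν}, e^{2β}, e^{2U}, e^{2V}`. -/
noncomputable def torusRicci (i j : Fin 4) : ℝ :=
  ricDiag ![-n⁻¹, b⁻¹, u⁻¹, v⁻¹]
    (fun i j l => torusJetOne n b u v (fun i => pd i ν R θ) (fun i => pd i β R θ)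
      (fun i => pd i U R θ) (fun i => pd i V R θ) (fun i => pd i A R θ) (fun i => pd i G R θ)
      (fun i => pd i H R θ) i j l)
    (fun m i j l => torusJetTwo n b u v (fun i => pd i ν R θ) (fun i => pd i β R θ)
      (fun i => pd i U R θ) (fun i => pd i V R θ) (fun i => pd i A R θ) (fun i => pd i G R θ)
      (fun i => pd i H R θ) (fun i j => pd i (pd j ν) R θ) (fun i j => pd i (pd j β) R θ)
      (fun i j => pd i (pd j U) R θ) (fun i j => pd i (pd j V) R θ) (fun i j => pd i (pd j A) R θ)
      (fun i j => pd i (pd j G) R θ) (fun i j => pd i (pd j H) R θ) m i j l) i j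

variable {n b u v}

theorem torusRicci_two_two (hn : n ≠ 0) (hb : b ≠ 0) (hu : u ≠ 0) (hv : v ≠ 0) :
    torusRicci n b u v ν β U V A G H R θ 2 2 = u * (n⁻¹ * (pd 0 (pd 0 U) R θ
        + (pd 0 β R θ - pd 0 ν R θ + pd 0 U R θ + pd 0 V R θ) * pd 0 U R θ)
      - b⁻¹ * (pd 1 (pd 1 U) R θ
        + (pd 1 ν R θ - pd 1 β R θ + pd 1 U R θ + pd 1 V R θ) * pd 1 U R θ)
      + 1 / 2 * u * (v⁻¹ * (-n⁻¹ * pd 0 A R θ ^ 2 + b⁻¹ * pd 1 A R θ ^ 2)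
        - n⁻¹ * b⁻¹ * pd 0 G R θ ^ 2)) := by
  simp [torusRicci, ricDiag, lowerChr, Fin.sum_univ_four, torusJetOne, torusJetTwo, pd_two,
    pd_three, pd_zero_fun]
  field_simp
  ring

theorem torusRicci_three_three (hn : n ≠ 0) (hb : b ≠ 0) (hu : u ≠ 0) (hv : v ≠ 0) :
    torusRicci n b u v ν β U V A G H R θ 3 3 = v * (n⁻¹ * (pd 0 (pd 0 V) R θ
        + (pd 0 β R θ - pd 0 ν R θ + pd 0 U R θ + pd 0 V R θ) * pd 0 V R θ)
      - b⁻¹ * (pd 1 (pd 1 V) R θ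
        + (pd 1 ν R θ - pd 1 β R θ + pd 1 U R θ + pd 1 V R θ) * pd 1 V R θ)
      - 1 / 2 * u * (v⁻¹ * (-n⁻¹ * pd 0 A R θ ^ 2 + b⁻¹ * pd 1 A R θ ^ 2))
      - 1 / 2 * v * n⁻¹ * b⁻¹ * pd 0 H R θ ^ 2) := by
  simp [torusRicci, ricDiag, lowerChr, Fin.sum_univ_four, torusJetOne, torusJetTwo, pd_two,
    pd_three, pd_zero_fun]
  field_simp
  ring

theorem torusRicci_two_three (hn : n ≠ 0) (hb : b ≠ 0) (hu : u ≠ 0) (hv : v ≠ 0) :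
    torusRicci n b u v ν β U V A G H R θ 2 3 = 1 / 2 * u * (n⁻¹ * (pd 0 (pd 0 A) R θ
        + (pd 0 β R θ - pd 0 ν R θ + 3 * pd 0 U R θ - pd 0 V R θ) * pd 0 A R θ)
      - b⁻¹ * (pd 1 (pd 1 A) R θ
        + (pd 1 ν R θ - pd 1 β R θ + 3 * pd 1 U R θ - pd 1 V R θ) * pd 1 A R θ)
      - v * n⁻¹ * b⁻¹ * pd 0 G R θ * pd 0 H R θ) := by
  simp [torusRicci, ricDiag, lowerChr, Fin.sum_univ_four, torusJetOne, torusJetTwo, pd_two,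
    pd_three, pd_zero_fun]
  field_simp
  ring

/-- The Hamiltonian constraint: twice the `(R, R)` component of the Einstein tensor contains no
second derivatives in `R`. -/
theorem torusRicci_hamiltonian (hn : n ≠ 0) (hb : b ≠ 0) (hu : u ≠ 0) (hv : v ≠ 0) :
    torusRicci n b u v ν β U V A G H R θ 0 0
      + n * b⁻¹ * torusRicci n b u v ν β U V A G H R θ 1 1
      + n * u⁻¹ * torusRicci n b u v ν β U V A G H R θ 2 2
      + n * v⁻¹ * torusRicci n b u v ν β U V A G H R θ 3 3
    = 2 * (pd 0 β R θ * (pd 0 U R θ + pd 0 V R θ) + pd 0 U R θ * pd 0 V R θ)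
      - 1 / 2 * u * v⁻¹ * (pd 0 A R θ ^ 2 + n * b⁻¹ * pd 1 A R θ ^ 2)
      - 1 / 2 * b⁻¹ * (u * pd 0 G R θ ^ 2 + v * pd 0 H R θ ^ 2)
      - 2 * n * b⁻¹ * (pd 1 (pd 1 U) R θ + pd 1 (pd 1 V) R θ + pd 1 U R θ ^ 2 + pd 1 V R θ ^ 2
        + pd 1 U R θ * pd 1 V R θ - pd 1 β R θ * (pd 1 U R θ + pd 1 V R θ)) := by
  simp [torusRicci, ricDiag, lowerChr, Fin.sum_univ_four, torusJetOne, torusJetTwo, pd_two,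
    pd_three, pd_zero_fun]
  field_simp
  ring

end TorusRicci

section TorusMetric

variable {R₁ R : ℝ} {ν β U V A G H : ℝ → ℝ → ℝ}

theorem SmoothStrip.det {M : ℝ → ℝ → Matrix (Fin 4) (Fin 4) ℝ}
    (h : ∀ i j, SmoothStrip R₁ fun R θ => M R θ i j) : SmoothStrip R₁ fun R θ => (M R θ).det := by
  simp only [Matrix.det_apply']
  exact SmoothStrip.sum (f := fun (σ : Equiv.Perm (Fin 4)) R θ =>
      ((Equiv.Perm.sign σ : ℤ) : ℝ) * ∏ i, M R θ (σ i) i) _ fun σ _ => (SmoothStrip.const _).mul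
    (SmoothStrip.prod (f := fun i R θ => M R θ (σ i) i) _ fun i _ => h _ _)

theorem SmoothMetric.of_entry {M : ℝ → ℝ → Matrix (Fin 4) (Fin 4) ℝ}
    (h : ∀ i j, SmoothStrip R₁ fun R θ => M R θ i j)
    (hdet : ∀ R ∈ Ioo 0 R₁, ∀ θ, (M R θ).det ≠ 0) : SmoothMetric R₁ M := by
  refine ⟨h, fun i j => ?_⟩
  simp only [Matrix.inv_def, Matrix.smul_apply, Matrix.adjugate_apply, smul_eq_mul,
    Ring.inverse_eq_inv']
  refine ((SmoothStrip.det h).inv hdet).mul (SmoothStrip.det fun k l => ?_)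
  by_cases hk : k = j
  · simpa [Matrix.updateRow_apply, hk] using SmoothStrip.const _
  · simpa [Matrix.updateRow_apply, hk] using h k l

theorem det_torusMatrix (ν β U V A G H : ℝ → ℝ → ℝ) (R θ : ℝ) :
    (torusMatrix ν β U V A G H R θ).det = -(Real.exp (2 * ν R θ) * Real.exp (2 * β R θ)
      * Real.exp (2 * U R θ) * Real.exp (2 * V R θ)) := by
  simp [torusMatrix, Matrix.det_succ_row_zero, Fin.sum_univ_succ, Fin.succAbove]
  ring

theorem smoothMetric_torusMatrix (hν : SmoothStrip R₁ ν) (hβ : SmoothStrip R₁ β)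
    (hU : SmoothStrip R₁ U) (hV : SmoothStrip R₁ V) (hA : SmoothStrip R₁ A)
    (hG : SmoothStrip R₁ G) (hH : SmoothStrip R₁ H) :
    SmoothMetric R₁ (torusMatrix ν β U V A G H) := by
  have en := hν.exp_two_mul
  have eb := hβ.exp_two_mul
  have eu := hU.exp_two_mul
  have ev := hV.exp_two_mul
  have hw := hG.add (hA.mul hH)
  have h0 : SmoothStrip R₁ fun _ _ => (0 : ℝ) := SmoothStrip.const 0
  refine SmoothMetric.of_entry (fun i j => ?_) fun R _ θ => ?_
  · have h11 := eb.add ((eu.mul (hw.mul hw)).add (ev.mul (hH.mul hH)))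
    have h12 := eu.mul hw
    have h13 := (eu.mul (hA.mul hw)).add (ev.mul hH)
    have h23 := eu.mul hA
    have h33 := (eu.mul (hA.mul hA)).add ev
    fin_cases i <;> fin_cases j <;>
      first | exact en.neg | exact h0 | exact h11 | exact h12 | exact h13 | exact eu
            | exact h23 | exact h33
  · rw [det_torusMatrix]
    simp [Real.exp_ne_zero]

theorem ric_torusMatrix (hν : SmoothStrip R₁ ν) (hβ : SmoothStrip R₁ β) (hU : SmoothStrip R₁ U)
    (hV : SmoothStrip R₁ V) (hA : SmoothStrip R₁ A) (hG : SmoothStrip R₁ G)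
    (hH : SmoothStrip R₁ H) (hR : R ∈ Ioo 0 R₁) {θ : ℝ} (hA0 : A R θ = 0) (hG0 : G R θ = 0)
    (hH0 : H R θ = 0) (i j : Fin 4) :
    ric (torusMatrix ν β U V A G H) i j R θ
      = torusRicci (Real.exp (2 * ν R θ)) (Real.exp (2 * β R θ)) (Real.exp (2 * U R θ))
        (Real.exp (2 * V R θ)) ν β U V A G H R θ i j := by
  have he : (torusMatrix ν β U V A G H R θ)⁻¹ = Matrix.diagonal ![-(Real.exp (2 * ν R θ))⁻¹,
      (Real.exp (2 * β R θ))⁻¹, (Real.exp (2 * U R θ))⁻¹, (Real.exp (2 * V R θ))⁻¹] := by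
    apply Matrix.inv_eq_right_inv
    ext i j
    fin_cases i <;> fin_cases j <;>
      simp [torusMatrix, hA0, hG0, hH0, Matrix.mul_apply, Matrix.diagonal_apply, Real.exp_ne_zero]
  rw [ric_eq_ricDiag (smoothMetric_torusMatrix hν hβ hU hV hA hG hH) (fun R _ θ => ?_) hR θ he]
  · simp only [pd_torusMatrix hν hβ hU hV hA hG hH hR hA0 hG0 hH0,
      pd_pd_torusMatrix hν hβ hU hV hA hG hH hR hA0 hG0 hH0]
    rfl
  · rw [det_torusMatrix]
    simp [Real.exp_ne_zero]

/-- A change of the torus coordinates makes the metric diagonal at a given point: the shear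
`x¹ ↦ x¹ + A₀ x²` removes `A` there, and shifts of `x¹, x²` by multiples of `θ` remove `G, H`. -/
theorem torusMatrix_congruence (A₀ G₀ H₀ : ℝ) (R θ : ℝ) :
    !![1, 0, 0, 0; 0, 1, 0, 0; 0, -G₀, 1, -A₀; 0, -H₀, 0, 1]ᵀ * torusMatrix ν β U V A G H R θ
      * !![1, 0, 0, 0; 0, 1, 0, 0; 0, -G₀, 1, -A₀; 0, -H₀, 0, 1]
    = torusMatrix ν β U V (fun R θ => A R θ - A₀) (fun R θ => G R θ - G₀ + A₀ * (H R θ - H₀))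
        (fun R θ => H R θ - H₀) R θ := by
  ext i j
  fin_cases i <;> fin_cases j <;>
    simp [torusMatrix, Matrix.mul_apply, Fin.sum_univ_four] <;> ring

theorem ric_congr {M M' : ℝ → ℝ → Matrix (Fin 4) (Fin 4) ℝ}
    (h : ∀ R ∈ Ioo 0 R₁, ∀ θ, M R θ = M' R θ) (hR : R ∈ Ioo 0 R₁) (θ : ℝ) (i j : Fin 4) :
    ric M i j R θ = ric M' i j R θ := by
  have hc : ∀ k i j, ∀ R ∈ Ioo 0 R₁, ∀ θ, chr M k i j R θ = chr M' k i j R θ := by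
    intro k i j R hR θ
    have hp : ∀ a i j, pd a (fun r t => M r t i j) R θ = pd a (fun r t => M' r t i j) R θ :=
      fun a i j => pd_congr (fun R hR θ => by rw [h R hR θ]) hR θ a
    simp only [chr, h R hR θ, hp]
  have hd : ∀ a k i j, pd a (chr M k i j) R θ = pd a (chr M' k i j) R θ :=
    fun a k i j => pd_congr (hc k i j) hR θ a
  simp only [ric, hd, hc _ _ _ R hR]

/-- A Ricci-flat torus-symmetric metric satisfies `torusRicci = 0` at every point, with `∂_i G`
replaced by the invariant combination `∂_i G + A ∂_i H`. -/
theorem torusRicci_eq_zero (hν : SmoothStrip R₁ ν) (hβ : SmoothStrip R₁ β) (hU : SmoothStrip R₁ U)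
    (hV : SmoothStrip R₁ V) (hA : SmoothStrip R₁ A) (hG : SmoothStrip R₁ G)
    (hH : SmoothStrip R₁ H) (hR : R ∈ Ioo 0 R₁) (θ : ℝ)
    (hflat : ∀ i j, ric (torusMatrix ν β U V A G H) i j R θ = 0) (i j : Fin 4) :
    torusRicci (Real.exp (2 * ν R θ)) (Real.exp (2 * β R θ)) (Real.exp (2 * U R θ))
      (Real.exp (2 * V R θ)) ν β U V (fun r t => A r t - A R θ)
      (fun r t => G r t - G R θ + A R θ * (H r t - H R θ)) (fun r t => H r t - H R θ) R θ i j
      = 0 := by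
  have hA' := hA.sub (SmoothStrip.const (A R θ))
  have hH' := hH.sub (SmoothStrip.const (H R θ))
  have hG' := (hG.sub (SmoothStrip.const (G R θ))).add ((SmoothStrip.const (A R θ)).mul hH')
  rw [← ric_torusMatrix hν hβ hU hV hA' hG' hH' hR (sub_self _) (by simp) (sub_self _)]
  have hN : !![1, 0, 0, 0; 0, 1, 0, 0; 0, -G R θ, 1, -A R θ; 0, -H R θ, 0, 1]
      * !![1, 0, 0, 0; 0, 1, 0, 0; 0, G R θ + A R θ * H R θ, 1, A R θ; 0, H R θ, 0, 1]
      = (1 : Matrix (Fin 4) (Fin 4) ℝ) := by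
    ext i j
    fin_cases i <;> fin_cases j <;> simp [Matrix.mul_apply, Fin.sum_univ_four]
  have h := ric_congruence rfl rfl hN (smoothMetric_torusMatrix hν hβ hU hV hA hG hH) hR θ i j
  simp only [torusMatrix_congruence, hflat, mul_zero, Finset.sum_const_zero] at h
  exact h

end TorusMetric

/-! ### The vacuum equations in areal coordinates -/

namespace ArealCoeffs

theorem metric_eq_torusMatrix (S : ArealCoeffs) {R θ : ℝ} (hR : 0 < R) (ha : 0 < S.a R θ) :
    S.metric ![R, θ, 0, 0] = torusMatrix (fun R θ => S.η R θ - S.U R θ)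
      (fun R θ => S.η R θ - S.U R θ - Real.log (S.a R θ)) S.U (fun R θ => Real.log R - S.U R θ)
      S.A S.G S.H R θ := by
  have hb : Real.exp (2 * (S.η R θ - S.U R θ - Real.log (S.a R θ)))
      = Real.exp (2 * (S.η R θ - S.U R θ)) * (S.a R θ ^ 2)⁻¹ := by
    rw [mul_sub, Real.exp_sub, two_mul (Real.log _), Real.exp_add, Real.exp_log ha]
    field_simp
  have hv : Real.exp (2 * (Real.log R - S.U R θ)) = Real.exp (-(2 * S.U R θ)) * R ^ 2 := by
    rw [mul_sub, sub_eq_add_neg, Real.exp_add, two_mul (Real.log _), Real.exp_add, Real.exp_log hR]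
    ring
  ext i j
  fin_cases i <;> fin_cases j <;>
    simp [metric, torusMatrix, hb, hv] <;> ring

namespace IsTwistedVacuum

variable {S : ArealCoeffs} {ℓ R₁ K : ℝ}

/-- Vanishing twist in the direction of `x¹` determines `G_R`. -/
theorem pd_G (hS : S.IsTwistedVacuum ℓ R₁ K) {R : ℝ} (hR : R ∈ Ioo 0 R₁) (θ : ℝ) :
    pd 0 S.G R θ + S.A R θ * pd 0 S.H R θ = 0 := by
  have h := congrFun (hS.twist_eq R hR θ) 0
  have hR0 := hR.1.ne'
  have ha := (hS.a_pos R hR θ).ne'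
  simp [twist, fiberMetric] at h
  simp only [pd, Matrix.cons_val_zero]
  rcases h with h | h
  · simp_all
  · have hu := Real.exp_ne_zero (2 * S.U R θ)
    apply mul_left_cancel₀ hu
    linear_combination h

theorem pd_H (hS : S.IsTwistedVacuum ℓ R₁ K) {R : ℝ} (hR : R ∈ Ioo 0 R₁) (θ : ℝ) :
    pd 0 S.H R θ = K * Real.exp (2 * S.η R θ) * (S.a R θ)⁻¹ * (R ^ 3)⁻¹ := by
  have h := congrFun (hS.twist_eq R hR θ) 1
  have hG := hS.pd_G hR θ
  have hR0 := hR.1.ne'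
  have ha := (hS.a_pos R hR θ).ne'
  have hu := Real.exp_ne_zero (2 * S.U R θ)
  have hw : Real.exp (2 * (S.η R θ - S.U R θ))
      = Real.exp (2 * S.η R θ) * (Real.exp (2 * S.U R θ))⁻¹ := by
    rw [mul_sub, sub_eq_add_neg, Real.exp_add, Real.exp_neg]
  have hw0 := Real.exp_ne_zero (2 * S.η R θ)
  simp [twist, fiberMetric] at h
  simp only [pd, Matrix.cons_val_zero] at hG ⊢
  rw [hw, Real.exp_neg] at h
  field_simp at h ⊢
  linear_combination h - (S.a R θ * R * Real.exp (2 * S.U R θ) ^ 2 * S.A R θ) * hG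

/-- The case `ν = η - U`, `β = η - U - log a`, `V = log R - U` of `torusRicci_eq_zero`. -/
theorem torusRicci_eq_zero (hS : S.IsTwistedVacuum ℓ R₁ K) {R : ℝ} (hR : R ∈ Ioo 0 R₁) (θ : ℝ)
    (i j : Fin 4) :
    torusRicci (Real.exp (2 * (S.η R θ - S.U R θ)))
      (Real.exp (2 * (S.η R θ - S.U R θ - Real.log (S.a R θ)))) (Real.exp (2 * S.U R θ))
      (Real.exp (2 * (Real.log R - S.U R θ))) (fun R θ => S.η R θ - S.U R θ)
      (fun R θ => S.η R θ - S.U R θ - Real.log (S.a R θ)) S.U (fun R θ => Real.log R - S.U R θ)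
      (fun r t => S.A r t - S.A R θ)
      (fun r t => S.G r t - S.G R θ + S.A R θ * (S.H r t - S.H R θ))
      (fun r t => S.H r t - S.H R θ) R θ i j = 0 := by
  have ha0 : ∀ R ∈ Ioo 0 R₁, ∀ θ, S.a R θ ≠ 0 := fun R hR θ => (hS.a_pos R hR θ).ne'
  have hν : SmoothStrip R₁ fun R θ => S.η R θ - S.U R θ :=
    SmoothStrip.sub hS.smooth_η hS.smooth_U
  refine _root_.torusRicci_eq_zero hν (hν.sub (SmoothStrip.log hS.smooth_a ha0))
    hS.smooth_U ((SmoothStrip.fst.log fun R hR _ => hR.1.ne').sub hS.smooth_U)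
    hS.smooth_A hS.smooth_G hS.smooth_H hR θ (fun i j => ?_) i j
  rw [← ric_congr (fun R hR θ => S.metric_eq_torusMatrix hR.1 (hS.a_pos R hR θ)) hR θ i j]
  exact (ricci_eq_ric (fun R θ => S.metric ![R, θ, 0, 0]) i j ![R, θ, 0, 0]).symm.trans
    (hS.ricci_flat ![R, θ, 0, 0] hR i j)

/-- The vacuum equations for torus-symmetric metrics in areal coordinates: evolution of `a` and
of `η` in `R`, and the wave equations satisfied by `U` and `A`. -/
theorem vacuum_equations (hS : S.IsTwistedVacuum ℓ R₁ K) {R : ℝ} (hR : R ∈ Ioo 0 R₁) (θ : ℝ) :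
    pd 0 S.a R θ = -(1 / 2) * K ^ 2 * Real.exp (2 * S.η R θ) * (R ^ 3)⁻¹ * S.a R θ ∧
    pd 0 S.η R θ = R * (pd 0 S.U R θ ^ 2 + S.a R θ ^ 2 * pd 1 S.U R θ ^ 2
      + 1 / 4 * Real.exp (2 * S.U R θ) ^ 2 * (R ^ 2)⁻¹
        * (pd 0 S.A R θ ^ 2 + S.a R θ ^ 2 * pd 1 S.A R θ ^ 2))
      - 1 / 4 * K ^ 2 * Real.exp (2 * S.η R θ) * (R ^ 3)⁻¹ ∧
    pd 0 (pd 0 S.U) R θ = -R⁻¹ * pd 0 S.U R θ + (S.a R θ)⁻¹ * pd 0 S.a R θ * pd 0 S.U R θ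
      + S.a R θ ^ 2 * pd 1 (pd 1 S.U) R θ + S.a R θ * pd 1 S.a R θ * pd 1 S.U R θ
      + 1 / 2 * Real.exp (2 * S.U R θ) ^ 2 * (R ^ 2)⁻¹
        * (pd 0 S.A R θ ^ 2 - S.a R θ ^ 2 * pd 1 S.A R θ ^ 2) ∧
    pd 0 (pd 0 S.A) R θ = R⁻¹ * pd 0 S.A R θ + (S.a R θ)⁻¹ * pd 0 S.a R θ * pd 0 S.A R θ
      - 4 * pd 0 S.U R θ * pd 0 S.A R θ + S.a R θ ^ 2 * pd 1 (pd 1 S.A) R θ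
      + S.a R θ * pd 1 S.a R θ * pd 1 S.A R θ
      + 4 * S.a R θ ^ 2 * pd 1 S.U R θ * pd 1 S.A R θ := by
  have ha0 : ∀ R ∈ Ioo 0 R₁, ∀ θ, S.a R θ ≠ 0 := fun R hR θ => (hS.a_pos R hR θ).ne'
  have sU : SmoothStrip R₁ S.U := hS.smooth_U
  have sA : SmoothStrip R₁ S.A := hS.smooth_A
  have sη : SmoothStrip R₁ S.η := hS.smooth_η
  have sa : SmoothStrip R₁ S.a := hS.smooth_a
  have sG : SmoothStrip R₁ S.G := hS.smooth_G
  have sH : SmoothStrip R₁ S.H := hS.smooth_H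
  have slog : SmoothStrip R₁ fun R _ => Real.log R := SmoothStrip.fst.log fun R hR _ => hR.1.ne'
  have hR0 := hR.1.ne'
  have ha := ha0 R hR θ
  have dν : ∀ i, pd i (fun R θ => S.η R θ - S.U R θ) R θ = pd i S.η R θ - pd i S.U R θ :=
    pd_sub sη sU hR θ
  have dβ : ∀ i, pd i (fun R θ => S.η R θ - S.U R θ - Real.log (S.a R θ)) R θ
      = pd i S.η R θ - pd i S.U R θ - (S.a R θ)⁻¹ * pd i S.a R θ := by
    intro i
    rw [pd_sub (sη.sub sU) (sa.log ha0) hR, dν, pd_log sa ha0 hR]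
  have dV0 : ∀ R ∈ Ioo 0 R₁, ∀ θ, pd 0 (fun R θ => Real.log R - S.U R θ) R θ
      = R⁻¹ - pd 0 S.U R θ := by
    intro R hR θ
    rw [pd_sub slog sU hR]
    simp [pd]
  have dV1 : ∀ R ∈ Ioo 0 R₁, ∀ θ, pd 1 (fun R θ => Real.log R - S.U R θ) R θ
      = -pd 1 S.U R θ := by
    intro R hR θ
    rw [pd_sub slog sU hR]
    simp [pd]
  have ddV0 : pd 0 (pd 0 (fun R θ => Real.log R - S.U R θ)) R θ
      = -(R ^ 2)⁻¹ - pd 0 (pd 0 S.U) R θ := by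
    rw [pd_congr dV0 hR, pd_sub (SmoothStrip.fst.inv fun R hR _ => hR.1.ne') (sU.pd 0) hR]
    simp [pd]
  have ddV1 : pd 1 (pd 1 (fun R θ => Real.log R - S.U R θ)) R θ = -pd 1 (pd 1 S.U) R θ := by
    rw [pd_congr dV1 hR, pd_neg]
  have dA : ∀ i c, pd i (fun r t => S.A r t - c) = pd i S.A := by
    intro i c; funext R θ; fin_cases i <;> simp [pd]
  have dH : ∀ i c, pd i (fun r t => S.H r t - c) R θ = pd i S.H R θ := by
    intro i c; fin_cases i <;> simp [pd]
  have dG : pd 0 (fun r t => S.G r t - S.G R θ + S.A R θ * (S.H r t - S.H R θ)) R θ = 0 := by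
    rw [pd_add (sG.sub (SmoothStrip.const _))
      ((SmoothStrip.const _).mul (sH.sub (SmoothStrip.const _))) hR,
      pd_sub sG (SmoothStrip.const _) hR, pd_const, pd_const_mul, dH, sub_zero, hS.pd_G hR θ]
  have dH0 := hS.pd_H hR θ
  have hexp : Real.exp (2 * (S.η R θ - S.U R θ))
      = Real.exp (2 * S.η R θ) * (Real.exp (2 * S.U R θ))⁻¹ := by
    rw [mul_sub, sub_eq_add_neg, Real.exp_add, Real.exp_neg]
  have hexb : Real.exp (2 * (S.η R θ - S.U R θ - Real.log (S.a R θ)))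
      = Real.exp (2 * S.η R θ) * (Real.exp (2 * S.U R θ))⁻¹ * (S.a R θ ^ 2)⁻¹ := by
    rw [mul_sub, Real.exp_sub, hexp, two_mul (Real.log _), Real.exp_add,
      Real.exp_log (hS.a_pos R hR θ)]
    field_simp
  have hexv : Real.exp (2 * (Real.log R - S.U R θ)) = R ^ 2 * (Real.exp (2 * S.U R θ))⁻¹ := by
    rw [mul_sub, sub_eq_add_neg, Real.exp_add, two_mul (Real.log _), Real.exp_add,
      Real.exp_log hR.1, Real.exp_neg]
    ring
  have hflat := hS.torusRicci_eq_zero hR θ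
  have e22 := hflat 2 2
  have e23 := hflat 2 3
  have e33 := hflat 3 3
  have e0 := torusRicci_hamiltonian (n := Real.exp (2 * (S.η R θ - S.U R θ)))
    (b := Real.exp (2 * (S.η R θ - S.U R θ - Real.log (S.a R θ))))
    (u := Real.exp (2 * S.U R θ)) (v := Real.exp (2 * (Real.log R - S.U R θ)))
    (fun R θ => S.η R θ - S.U R θ)
    (fun R θ => S.η R θ - S.U R θ - Real.log (S.a R θ)) S.U (fun R θ => Real.log R - S.U R θ)
    (fun r t => S.A r t - S.A R θ)
    (fun r t => S.G r t - S.G R θ + S.A R θ * (S.H r t - S.H R θ))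
    (fun r t => S.H r t - S.H R θ) R θ (Real.exp_ne_zero _) (Real.exp_ne_zero _)
    (Real.exp_ne_zero _) (Real.exp_ne_zero _)
  simp only [hflat, mul_zero, add_zero] at e0
  rw [torusRicci_two_two _ _ _ _ _ _ _ _ _ (Real.exp_ne_zero _) (Real.exp_ne_zero _)
    (Real.exp_ne_zero _) (Real.exp_ne_zero _)] at e22
  rw [torusRicci_two_three _ _ _ _ _ _ _ _ _ (Real.exp_ne_zero _) (Real.exp_ne_zero _)
    (Real.exp_ne_zero _) (Real.exp_ne_zero _)] at e23
  rw [torusRicci_three_three _ _ _ _ _ _ _ _ _ (Real.exp_ne_zero _) (Real.exp_ne_zero _)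
    (Real.exp_ne_zero _) (Real.exp_ne_zero _)] at e33
  simp only [dν, dβ, dV0 R hR θ, dV1 R hR θ, ddV0, ddV1, dA, dH, dG, dH0, hexp, hexb, hexv]
    at e0 e22 e23 e33
  have hu := Real.exp_ne_zero (2 * S.U R θ)
  have hw := Real.exp_ne_zero (2 * S.η R θ)
  generalize Real.exp (2 * S.U R θ) = u at *
  generalize Real.exp (2 * S.η R θ) = w at *
  have e22' := (mul_eq_zero.1 e22).resolve_left hu
  have e33' := (mul_eq_zero.1 e33).resolve_left (by positivity)
  have ea : pd 0 S.a R θ = -(1 / 2) * K ^ 2 * w * (R ^ 3)⁻¹ * S.a R θ := by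
    -- the trace over the torus is the wave equation of `U + V = log R`, which is first order in `a`
    linear_combination (norm := skip) (-(w / u) * R * S.a R θ) * (e22' + e33')
    field_simp
    ring
  refine ⟨ea, ?_, ?_, ?_⟩
  · linear_combination (norm := skip) -(R / 2) * e0 + (S.a R θ)⁻¹ * ea
    field_simp
    ring
  · linear_combination (norm := skip) (w / u) * e22'
    field_simp
    ring
  · linear_combination (norm := skip) (2 / u) * (w / u) * e23
    field_simp
    ring

end IsTwistedVacuum

end ArealCoeffs

/-! ### The monotone energy -/

theorem hasDerivAt_integral_strip {R₁ R : ℝ} {F : ℝ → ℝ → ℝ} (hF : SmoothStrip R₁ F)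
    (hR : R ∈ Ioo 0 R₁) {ℓ : ℝ} :
    HasDerivAt (fun r => ∫ θ in (0 : ℝ)..ℓ, F r θ) (∫ θ in (0 : ℝ)..ℓ, pd 0 F R θ) R := by
  obtain ⟨ε, hε, hball⟩ := Metric.nhds_basis_closedBall.mem_iff.1 (isOpen_Ioo.mem_nhds hR)
  have hK : IsCompact (Metric.closedBall R ε ×ˢ uIcc 0 ℓ) :=
    (isCompact_closedBall R ε).prod isCompact_uIcc
  obtain ⟨C, hC⟩ := hK.exists_bound_of_continuousOn
    ((hF.pd 0).continuousOn.mono (prod_mono hball (subset_univ _)))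
  have hs : Metric.closedBall R ε ∈ nhds R := Metric.closedBall_mem_nhds R hε
  refine (intervalIntegral.hasDerivAt_integral_of_dominated_loc_of_deriv_le (bound := fun _ => C)
    (F := F) (F' := fun r θ => pd 0 F r θ) hs ?_ ?_ ?_ ?_ ?_ ?_).2
  · filter_upwards [hs] with r hr
    exact (hF.continuous_snd (hball hr)).aestronglyMeasurable
  · exact (hF.continuous_snd hR).intervalIntegrable _ _
  · exact ((hF.pd 0).continuous_snd hR).aestronglyMeasurable
  · exact Eventually.of_forall fun t ht r hr => hC (r, t) ⟨hr, uIoc_subset_uIcc ht⟩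
  · exact intervalIntegrable_const
  · exact Eventually.of_forall fun t _ r hr => hF.hasDerivAt_fst (hball hr) t

theorem pd_add_period {R₁ R ℓ c : ℝ} {F : ℝ → ℝ → ℝ}
    (h : ∀ R ∈ Ioo 0 R₁, ∀ θ, F R (θ + ℓ) = F R θ + c) (hR : R ∈ Ioo 0 R₁) (θ : ℝ) (i : Fin 4) :
    pd i F R (θ + ℓ) = pd i F R θ := by
  have h0 : deriv (fun r => F r (θ + ℓ)) R = deriv (fun r => F r θ) R := by
    have : (fun r => F r (θ + ℓ)) =ᶠ[nhds R] fun r => F r θ + c := by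
      filter_upwards [isOpen_Ioo.mem_nhds hR] with r hr using h r hr θ
    rw [this.deriv_eq, deriv_add_const]
  have h1 : deriv (fun t => F R t) (θ + ℓ) = deriv (fun t => F R t) θ := by
    rw [← deriv_comp_add_const, show (fun t => F R (t + ℓ)) = fun t => F R t + c from
      funext (h R hR), deriv_add_const]
  simp [pd, h0, h1]

namespace ArealCoeffs

/-- The density of the energy of `U` and `A` on the slices of constant `R`, plus two positive terms.
The one with `K ^ 2` compensates the growth of the weights `a` caused by the twist; the `R`-derivative
of its factor `(R ^ 2)⁻¹` is in turn compensated by that of the last term `a⁻¹`. -/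
noncomputable def energyDensity (S : ArealCoeffs) (K R θ : ℝ) : ℝ :=
  R ^ 2 * ((S.a R θ)⁻¹ * pd 0 S.U R θ ^ 2 + S.a R θ * pd 1 S.U R θ ^ 2)
    + 1 / 4 * Real.exp (2 * S.U R θ) ^ 2
      * ((S.a R θ)⁻¹ * pd 0 S.A R θ ^ 2 + S.a R θ * pd 1 S.A R θ ^ 2)
    + 1 / 4 * K ^ 2 * Real.exp (2 * S.η R θ) * (S.a R θ)⁻¹ * (R ^ 2)⁻¹ + (S.a R θ)⁻¹

/-- The spatial flux of the energy. -/
noncomputable def energyFlux (S : ArealCoeffs) (R θ : ℝ) : ℝ :=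
  S.a R θ * (2 * R ^ 2 * (pd 0 S.U R θ * pd 1 S.U R θ)
    + 1 / 2 * Real.exp (2 * S.U R θ) ^ 2 * (pd 0 S.A R θ * pd 1 S.A R θ))

/-- The dissipation rate of the energy as `R` decreases to `0`. -/
noncomputable def energyDissipation (S : ArealCoeffs) (R θ : ℝ) : ℝ :=
  2 * R * (S.a R θ * pd 1 S.U R θ ^ 2)
    + 1 / 2 * R⁻¹ * Real.exp (2 * S.U R θ) ^ 2 * ((S.a R θ)⁻¹ * pd 0 S.A R θ ^ 2)

namespace IsTwistedVacuum

variable {S : ArealCoeffs} {ℓ R₁ K : ℝ}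

theorem smoothStrip_energyDensity (hS : S.IsTwistedVacuum ℓ R₁ K) :
    SmoothStrip R₁ (S.energyDensity K) := by
  have sU : SmoothStrip R₁ S.U := hS.smooth_U
  have sA : SmoothStrip R₁ S.A := hS.smooth_A
  have sη : SmoothStrip R₁ S.η := hS.smooth_η
  have sa : SmoothStrip R₁ S.a := hS.smooth_a
  have sai := sa.inv fun R hR θ => (hS.a_pos R hR θ).ne'
  have sR : SmoothStrip R₁ fun R _ => R := SmoothStrip.fst
  have sRi : SmoothStrip R₁ fun R _ => (R * R)⁻¹ :=
    (sR.mul sR).inv fun R hR _ => (mul_pos hR.1 hR.1).ne'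
  have hsq : ∀ {F : ℝ → ℝ → ℝ}, SmoothStrip R₁ F → SmoothStrip R₁ fun R θ => F R θ * F R θ :=
    fun h => h.mul h
  refine (((((hsq sR).mul ((sai.mul (hsq (sU.pd 0))).add (sa.mul (hsq (sU.pd 1))))).add
    (((SmoothStrip.const (1 / 4)).mul (hsq sU.exp_two_mul)).mul
      ((sai.mul (hsq (sA.pd 0))).add (sa.mul (hsq (sA.pd 1)))))).add
    ((((SmoothStrip.const (1 / 4 * K ^ 2)).mul sη.exp_two_mul).mul sai).mul sRi)).add sai).congr ?_
  intro R _ θ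
  simp only [energyDensity, sq]

theorem smoothStrip_energyFlux (hS : S.IsTwistedVacuum ℓ R₁ K) :
    SmoothStrip R₁ S.energyFlux := by
  have sU : SmoothStrip R₁ S.U := hS.smooth_U
  have sA : SmoothStrip R₁ S.A := hS.smooth_A
  have sa : SmoothStrip R₁ S.a := hS.smooth_a
  have sR : SmoothStrip R₁ fun R _ => R := SmoothStrip.fst
  refine (sa.mul ((((SmoothStrip.const 2).mul (sR.mul sR)).mul ((sU.pd 0).mul (sU.pd 1))).add
    (((SmoothStrip.const (1 / 2)).mul (sU.exp_two_mul.mul sU.exp_two_mul)).mul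
      ((sA.pd 0).mul (sA.pd 1))))).congr ?_
  intro R _ θ
  simp only [energyFlux, sq]

/-- Local conservation law for the energy: up to a divergence, its density grows with `R` at the
rate `energyDissipation`. -/
theorem pd_energyDensity (hS : S.IsTwistedVacuum ℓ R₁ K) {R : ℝ} (hR : R ∈ Ioo 0 R₁) (θ : ℝ) :
    pd 0 (S.energyDensity K) R θ = S.energyDissipation R θ + pd 1 S.energyFlux R θ := by
  have sU : SmoothStrip R₁ S.U := hS.smooth_U
  have sA : SmoothStrip R₁ S.A := hS.smooth_A
  have sη : SmoothStrip R₁ S.η := hS.smooth_η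
  have sa : SmoothStrip R₁ S.a := hS.smooth_a
  have ha := (hS.a_pos R hR θ).ne'
  have hR0 := hR.1.ne'
  obtain ⟨ea, eη, eU, eA⟩ := hS.vacuum_equations hR θ
  have dR := hasDerivAt_id R
  have d0a := sa.hasDerivAt_fst hR θ
  have h0 : HasDerivAt (fun r => S.energyDensity K r θ) _ R :=
    ((((dR.pow 2).mul (((d0a.inv ha).mul (((sU.pd 0).hasDerivAt_fst hR θ).pow 2)).add
      (d0a.mul (((sU.pd 1).hasDerivAt_fst hR θ).pow 2)))).add
    (((hasDerivAt_const R (1 / 4 : ℝ)).mul ((sU.exp_two_mul.hasDerivAt_fst hR θ).pow 2)).mul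
      (((d0a.inv ha).mul (((sA.pd 0).hasDerivAt_fst hR θ).pow 2)).add
        (d0a.mul (((sA.pd 1).hasDerivAt_fst hR θ).pow 2))))).add
    ((((hasDerivAt_const R (1 / 4 * K ^ 2 : ℝ)).mul (sη.exp_two_mul.hasDerivAt_fst hR θ)).mul
      (d0a.inv ha)).mul ((dR.pow 2).inv (pow_ne_zero 2 hR0)))).add (d0a.inv ha)
  have h1 : HasDerivAt (fun t => S.energyFlux R t) _ θ :=
    (sa.hasDerivAt_snd hR θ).mul ((((hasDerivAt_const θ (2 * R ^ 2 : ℝ))).mul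
      (((sU.pd 0).hasDerivAt_snd hR θ).mul ((sU.pd 1).hasDerivAt_snd hR θ))).add
      (((hasDerivAt_const θ (1 / 2 : ℝ)).mul ((sU.exp_two_mul.hasDerivAt_snd hR θ).pow 2)).mul
      (((sA.pd 0).hasDerivAt_snd hR θ).mul ((sA.pd 1).hasDerivAt_snd hR θ))))
  have e0 : pd 0 (S.energyDensity K) R θ = _ := h0.deriv
  have e1 : pd 1 S.energyFlux R θ = _ := h1.deriv
  rw [e0, e1]
  simp only [id, Pi.pow_apply, Pi.mul_apply, Pi.add_apply, Pi.inv_apply,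
    pd_exp_two_mul sU hR, pd_exp_two_mul sη hR, pd_comm sU hR θ 0 1,
    pd_comm sA hR θ 0 1, eU, eA, eη, energyDissipation]
  rw [ea]
  field_simp
  ring

theorem integral_pd_energyFlux (hS : S.IsTwistedVacuum ℓ R₁ K) {R : ℝ} (hR : R ∈ Ioo 0 R₁) :
    ∫ θ in (0 : ℝ)..ℓ, pd 1 S.energyFlux R θ = 0 := by
  rw [intervalIntegral.integral_eq_sub_of_hasDerivAt
    (fun θ _ => hS.smoothStrip_energyFlux.hasDerivAt_snd hR θ)
    (((hS.smoothStrip_energyFlux.pd 1).continuous_snd hR).intervalIntegrable _ _)]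
  obtain ⟨c, hc⟩ := hS.periodic
  have hU := pd_add_period (F := S.U) (ℓ := ℓ) (c := 0) (fun R hR θ => by simp [(hc R hR θ).1]) hR 0
  have hA := pd_add_period (F := S.A) (ℓ := ℓ) (c := c) (fun R hR θ => (hc R hR θ).2.2.2.2.1) hR 0
  have h1 := (hc R hR 0).1
  have h2 := (hc R hR 0).2.2.1
  simp only [zero_add] at hU hA h1 h2
  simp [energyFlux, hU, hA, h1, h2]

theorem hasDerivAt_energy (hS : S.IsTwistedVacuum ℓ R₁ K) {R : ℝ} (hR : R ∈ Ioo 0 R₁) :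
    HasDerivAt (fun r => ∫ θ in (0 : ℝ)..ℓ, S.energyDensity K r θ)
      (∫ θ in (0 : ℝ)..ℓ, pd 0 (S.energyDensity K) R θ) R :=
  hasDerivAt_integral_strip hS.smoothStrip_energyDensity hR

/-- The `R`-derivative of the energy controls the spatial derivative of `U`. -/
theorem le_deriv_energy (hS : S.IsTwistedVacuum ℓ R₁ K) {R : ℝ} (hR : R ∈ Ioo 0 R₁) :
    2 * R * ∫ θ in (0 : ℝ)..ℓ, S.a R θ * pd 1 S.U R θ ^ 2
      ≤ ∫ θ in (0 : ℝ)..ℓ, pd 0 (S.energyDensity K) R θ := by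
  have sU : SmoothStrip R₁ S.U := hS.smooth_U
  have sa : SmoothStrip R₁ S.a := hS.smooth_a
  have i0 := ((hS.smoothStrip_energyDensity.pd 0).continuous_snd hR).intervalIntegrable
    (μ := volume) 0 ℓ
  have i1 := ((hS.smoothStrip_energyFlux.pd 1).continuous_snd hR).intervalIntegrable
    (μ := volume) 0 ℓ
  have i2 : Continuous fun θ => S.a R θ * pd 1 S.U R θ ^ 2 :=
    (sa.continuous_snd hR).mul (((sU.pd 1).continuous_snd hR).pow 2)
  have h := intervalIntegral.integral_sub i0 i1
  rw [hS.integral_pd_energyFlux hR, sub_zero] at h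
  rw [← h, ← intervalIntegral.integral_const_mul]
  refine intervalIntegral.integral_mono_on hS.length_pos.le
    ((i2.const_mul _).intervalIntegrable _ _) (i0.sub i1) fun θ _ => ?_
  rw [hS.pd_energyDensity hR, add_sub_cancel_right, energyDissipation]
  have ha := hS.a_pos R hR θ
  have hR0 := hR.1
  have : 0 ≤ 1 / 2 * R⁻¹ * Real.exp (2 * S.U R θ) ^ 2 * ((S.a R θ)⁻¹ * pd 0 S.A R θ ^ 2) := by
    positivity
  linarith

theorem energy_nonneg (hS : S.IsTwistedVacuum ℓ R₁ K) {R : ℝ} (hR : R ∈ Ioo 0 R₁) :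
    0 ≤ ∫ θ in (0 : ℝ)..ℓ, S.energyDensity K R θ := by
  refine intervalIntegral.integral_nonneg hS.length_pos.le fun θ _ => ?_
  have ha := hS.a_pos R hR θ
  have hR0 := hR.1
  rw [energyDensity]
  positivity

end IsTwistedVacuum

end ArealCoeffs

/-! ### Estimates in the negative Sobolev norm -/

/-- The Cauchy-Schwarz inequality with weight `w`. -/
theorem sq_integral_mul_le {ℓ : ℝ} (hℓ : 0 ≤ ℓ) {w f g : ℝ → ℝ} (hw : Continuous w)
    (hw0 : ∀ θ, 0 ≤ w θ) (hf : Continuous f) (hg : Continuous g) :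
    (∫ θ in (0 : ℝ)..ℓ, w θ * (f θ * g θ)) ^ 2
      ≤ (∫ θ in (0 : ℝ)..ℓ, w θ * f θ ^ 2) * ∫ θ in (0 : ℝ)..ℓ, w θ * g θ ^ 2 := by
  have iff : IntervalIntegrable (fun θ => w θ * f θ ^ 2) volume 0 ℓ :=
    (hw.mul (hf.pow 2)).intervalIntegrable _ _
  have ifg : IntervalIntegrable (fun θ => w θ * (f θ * g θ)) volume 0 ℓ :=
    (hw.mul (hf.mul hg)).intervalIntegrable _ _
  have igg : IntervalIntegrable (fun θ => w θ * g θ ^ 2) volume 0 ℓ :=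
    (hw.mul (hg.pow 2)).intervalIntegrable _ _
  -- `∫ w (t f + g) ^ 2` is a nonnegative quadratic polynomial in `t`
  have h := discrim_le_zero (a := ∫ θ in (0 : ℝ)..ℓ, w θ * f θ ^ 2)
    (b := 2 * ∫ θ in (0 : ℝ)..ℓ, w θ * (f θ * g θ)) (c := ∫ θ in (0 : ℝ)..ℓ, w θ * g θ ^ 2)
    fun t => by
      have h0 : 0 ≤ ∫ θ in (0 : ℝ)..ℓ, w θ * (t * f θ + g θ) ^ 2 :=
        intervalIntegral.integral_nonneg hℓ fun θ _ => mul_nonneg (hw0 θ) (sq_nonneg _)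
      have h1 : ∀ θ, w θ * (t * f θ + g θ) ^ 2
          = (t * t) * (w θ * f θ ^ 2) + (2 * t) * (w θ * (f θ * g θ)) + w θ * g θ ^ 2 := by
        intro θ; ring
      simp only [h1] at h0
      rw [intervalIntegral.integral_add ((iff.const_mul _).add (ifg.const_mul _)) igg,
        intervalIntegral.integral_add (iff.const_mul _) (ifg.const_mul _),
        intervalIntegral.integral_const_mul, intervalIntegral.integral_const_mul] at h0
      linarith
  rw [discrim] at h
  linarith

/-- The negative Sobolev norm of a divergence `a g_θ` is bounded by a weighted `L²` norm of `g`. -/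
theorem negSobolevNorm_le {ℓ c : ℝ} (hℓ : 0 < ℓ) (hc : 0 ≤ c) {a g g' σ : ℝ → ℝ}
    (ha : Continuous a) (ha0 : ∀ θ, 0 < a θ) (hg : ∀ θ, HasDerivAt g (g' θ) θ)
    (hg' : Continuous g') (hgp : Function.Periodic g ℓ) (hσ : Continuous σ) :
    negSobolevNorm ℓ a (fun θ => a θ * g' θ - c * σ θ)
      ≤ ENNReal.ofReal (Real.sqrt (∫ θ in (0 : ℝ)..ℓ, (a θ)⁻¹ * g θ ^ 2))
        + ENNReal.ofReal c * negSobolevNorm ℓ a σ := by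
  refine iSup₂_le fun φ ⟨hφ, hφp, hφ0⟩ => ?_
  have hai : Continuous fun θ => (a θ)⁻¹ := ha.inv₀ fun θ => (ha0 θ).ne'
  have hgc : Continuous g := continuous_iff_continuousAt.2 fun θ => (hg θ).continuousAt
  have hφd : ∀ θ, HasDerivAt φ (deriv φ θ) θ := fun θ =>
    (hφ.differentiable (by simp) θ).hasDerivAt
  have hφ' : Continuous (deriv φ) := hφ.continuous_deriv (by simp)
  set D := Real.sqrt (∫ θ in (0 : ℝ)..ℓ, (φ θ ^ 2 + a θ ^ 2 * deriv φ θ ^ 2) * (a θ)⁻¹) with hD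
  have hD0 : 0 ≤ D := Real.sqrt_nonneg _
  have i1 : IntervalIntegrable (fun θ => g' θ * φ θ) volume 0 ℓ :=
    (hg'.mul hφ.continuous).intervalIntegrable _ _
  have i2 : IntervalIntegrable (fun θ => g θ * deriv φ θ) volume 0 ℓ :=
    (hgc.mul hφ').intervalIntegrable _ _
  have i3 : IntervalIntegrable (fun θ => σ θ * -φ θ * (a θ)⁻¹) volume 0 ℓ :=
    ((hσ.mul hφ.continuous.neg).mul hai).intervalIntegrable _ _
  have hparts : ∫ θ in (0 : ℝ)..ℓ, g' θ * φ θ = -∫ θ in (0 : ℝ)..ℓ, g θ * deriv φ θ := by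
    have h := intervalIntegral.integral_eq_sub_of_hasDerivAt
      (fun θ _ => (hg θ).mul (hφd θ)) (i1.add i2)
    rw [intervalIntegral.integral_add i1 i2] at h
    have e1 : g ℓ = g 0 := by simpa using hgp 0
    have e2 : φ ℓ = φ 0 := by simpa using hφp 0
    simp only [Pi.mul_apply, e1, e2, sub_self] at h
    linarith
  have hsplit : ∫ θ in (0 : ℝ)..ℓ, (a θ * g' θ - c * σ θ) * φ θ * (a θ)⁻¹
      = (∫ θ in (0 : ℝ)..ℓ, g' θ * φ θ) + c * ∫ θ in (0 : ℝ)..ℓ, σ θ * -φ θ * (a θ)⁻¹ := by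
    rw [← intervalIntegral.integral_const_mul, ← intervalIntegral.integral_add i1 (i3.const_mul c)]
    refine intervalIntegral.integral_congr fun θ _ => ?_
    have := (ha0 θ).ne'
    field_simp
    ring
  have hmain : (∫ θ in (0 : ℝ)..ℓ, g' θ * φ θ)
      ≤ Real.sqrt (∫ θ in (0 : ℝ)..ℓ, (a θ)⁻¹ * g θ ^ 2) * D := by
    have hcs := sq_integral_mul_le (g := fun θ => a θ * deriv φ θ) hℓ.le hai (fun θ => (inv_pos.2 (ha0 θ)).le) hgc
      (ha.mul hφ')
    have h1 : ∀ θ, (a θ)⁻¹ * (g θ * (a θ * deriv φ θ)) = g θ * deriv φ θ := by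
      intro θ
      have := (ha0 θ).ne'
      field_simp
    simp only [h1] at hcs
    have h2 : ∫ θ in (0 : ℝ)..ℓ, (a θ)⁻¹ * (a θ * deriv φ θ) ^ 2
        ≤ ∫ θ in (0 : ℝ)..ℓ, (φ θ ^ 2 + a θ ^ 2 * deriv φ θ ^ 2) * (a θ)⁻¹ := by
      refine intervalIntegral.integral_mono_on hℓ.le
        ((hai.mul ((ha.mul hφ').pow 2)).intervalIntegrable _ _)
        ((((hφ.continuous.pow 2).add ((ha.pow 2).mul (hφ'.pow 2))).mul hai).intervalIntegrable _ _)
        fun θ _ => ?_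
      have := mul_nonneg (sq_nonneg (φ θ)) (inv_pos.2 (ha0 θ)).le
      nlinarith
    have h3 : 0 ≤ ∫ θ in (0 : ℝ)..ℓ, (a θ)⁻¹ * g θ ^ 2 :=
      intervalIntegral.integral_nonneg hℓ.le fun θ _ =>
        mul_nonneg (inv_pos.2 (ha0 θ)).le (sq_nonneg _)
    rw [hparts, hD, ← Real.sqrt_mul h3]
    refine (neg_le_abs _).trans (Real.abs_le_sqrt ?_)
    exact hcs.trans (mul_le_mul_of_nonneg_left h2 h3)
  -- the remaining term is tested against `-φ`, which has the same denominator
  have hneg : ENNReal.ofReal ((∫ θ in (0 : ℝ)..ℓ, σ θ * -φ θ * (a θ)⁻¹) / D)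
      ≤ negSobolevNorm ℓ a σ := by
    have h := le_iSup₂ (f := fun (φ : ℝ → ℝ)
      (_ : ContDiff ℝ ∞ φ ∧ Function.Periodic φ ℓ ∧ φ ≠ 0) => ENNReal.ofReal
      ((∫ θ in (0 : ℝ)..ℓ, σ θ * φ θ * (a θ)⁻¹) /
        Real.sqrt (∫ θ in (0 : ℝ)..ℓ, (φ θ ^ 2 + a θ ^ 2 * deriv φ θ ^ 2) * (a θ)⁻¹)))
      (-φ) ⟨hφ.neg, fun θ => by simp [hφp θ], neg_ne_zero.2 hφ0⟩
    simpa [negSobolevNorm, hD] using h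
  rw [hsplit, add_div, mul_div_assoc]
  refine ENNReal.ofReal_add_le.trans (add_le_add (ENNReal.ofReal_le_ofReal ?_) ?_)
  · exact div_le_of_le_mul₀ hD0 (Real.sqrt_nonneg _) hmain
  · rw [ENNReal.ofReal_mul hc]
    exact mul_le_mul_right hneg _

/-! ### The deviation from velocity domination -/

theorem hasDerivAt_exp_neg (τ : ℝ) : HasDerivAt (fun s => Real.exp (-s)) (-Real.exp (-τ)) τ := by
  simpa using (hasDerivAt_neg τ).exp

theorem hasDerivAt_comp_exp_neg {F : ℝ → ℝ → ℝ} (hF : SmoothStrip R₁ F) {τ : ℝ}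
    (hR : Real.exp (-τ) ∈ Ioo 0 R₁) (θ : ℝ) :
    HasDerivAt (fun s => F (Real.exp (-s)) θ) (-Real.exp (-τ) * pd 0 F (Real.exp (-τ)) θ) τ := by
  have := (hF.hasDerivAt_fst hR θ).comp τ (hasDerivAt_exp_neg τ)
  rw [mul_comm] at this
  exact this

namespace ArealCoeffs.IsTwistedVacuum

variable {S : ArealCoeffs} {ℓ R₁ K : ℝ}

/-- The wave equation of `U` in the time variable `τ`. -/
theorem avtdTerm_eq (hS : S.IsTwistedVacuum ℓ R₁ K) {τ : ℝ} (hR : Real.exp (-τ) ∈ Ioo 0 R₁)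
    (θ : ℝ) :
    S.avtdTerm τ θ = S.a (Real.exp (-τ)) θ
        * (Real.exp (-τ) ^ 2 * (pd 1 S.a (Real.exp (-τ)) θ * pd 1 S.U (Real.exp (-τ)) θ
          + S.a (Real.exp (-τ)) θ * pd 1 (pd 1 S.U) (Real.exp (-τ)) θ))
      - 1 / 2 * S.spatialTerm τ θ := by
  have sU : SmoothStrip R₁ S.U := hS.smooth_U
  have sA : SmoothStrip R₁ S.A := hS.smooth_A
  have sa : SmoothStrip R₁ S.a := hS.smooth_a
  have ha := (hS.a_pos _ hR θ).ne'
  have hev : ∀ᶠ s in nhds τ, Real.exp (-s) ∈ Ioo 0 R₁ :=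
    (hasDerivAt_exp_neg τ).continuousAt.eventually (isOpen_Ioo.mem_nhds hR)
  have h1 : (fun s => (S.a (Real.exp (-s)) θ)⁻¹ * deriv (fun r => S.U (Real.exp (-r)) θ) s)
      =ᶠ[nhds τ] fun s => (S.a (Real.exp (-s)) θ)⁻¹
        * (-Real.exp (-s) * pd 0 S.U (Real.exp (-s)) θ) := by
    filter_upwards [hev] with s hs
    rw [(hasDerivAt_comp_exp_neg sU hs θ).deriv]
  have h2 : HasDerivAt (fun s => (S.a (Real.exp (-s)) θ)⁻¹
        * (-Real.exp (-s) * pd 0 S.U (Real.exp (-s)) θ)) _ τ :=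
    ((hasDerivAt_comp_exp_neg sa hR θ).inv ha).mul
      ((hasDerivAt_exp_neg τ).neg.mul (hasDerivAt_comp_exp_neg (sU.pd 0) hR θ))
  obtain ⟨-, -, eU, -⟩ := hS.vacuum_equations hR θ
  have e4 : Real.exp (4 * S.U (Real.exp (-τ)) θ) = Real.exp (2 * S.U (Real.exp (-τ)) θ) ^ 2 := by
    rw [← Real.exp_nat_mul]; congr 1; push_cast; ring
  have e2 : Real.exp (2 * τ) = (Real.exp (-τ) ^ 2)⁻¹ := by
    rw [← Real.exp_nat_mul, ← Real.exp_neg]; congr 1; push_cast; ring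
  have hp : deriv (fun t => S.A (Real.exp (-τ)) t) θ = pd 1 S.A (Real.exp (-τ)) θ := rfl
  rw [avtdTerm, spatialTerm, h1.deriv_eq, h2.deriv, (hasDerivAt_comp_exp_neg sA hR θ).deriv, e4, e2,
    hp]
  simp only [eU, Pi.neg_apply, Pi.inv_apply]
  have hR0 := Real.exp_ne_zero (-τ)
  generalize Real.exp (-τ) = R at *
  field_simp
  ring

/-- The deviation from velocity domination is controlled by the dissipation of the energy and by
the spatial derivative of `A`. -/
theorem negSobolevNorm_avtdTerm_le (hS : S.IsTwistedVacuum ℓ R₁ K) {τ : ℝ}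
    (hR : Real.exp (-τ) ∈ Ioo 0 R₁) :
    negSobolevNorm ℓ (S.a (Real.exp (-τ))) (S.avtdTerm τ)
      ≤ ENNReal.ofReal (Real.sqrt (Real.exp (-τ) ^ 4
          * ∫ θ in (0 : ℝ)..ℓ, S.a (Real.exp (-τ)) θ * pd 1 S.U (Real.exp (-τ)) θ ^ 2))
        + ENNReal.ofReal (1 / 2) * negSobolevNorm ℓ (S.a (Real.exp (-τ))) (S.spatialTerm τ) := by
  have sU : SmoothStrip R₁ S.U := hS.smooth_U
  have sA : SmoothStrip R₁ S.A := hS.smooth_A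
  have sa : SmoothStrip R₁ S.a := hS.smooth_a
  obtain ⟨c, hc⟩ := hS.periodic
  have cU := sU.continuous_snd hR
  have cU1 := (sU.pd 1).continuous_snd hR
  have cU2 := ((sU.pd 1).pd 1).continuous_snd hR
  have ca := sa.continuous_snd hR
  have ca1 := (sa.pd 1).continuous_snd hR
  have cA1 := (sA.pd 1).continuous_snd hR
  have cσ : Continuous (S.spatialTerm τ) :=
    ((Real.continuous_exp.comp (cU.const_mul 4)).mul (ca.pow 2)).mul (cA1.pow 2)
  have hgp : Function.Periodic (fun θ => Real.exp (-τ) ^ 2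
      * (S.a (Real.exp (-τ)) θ * pd 1 S.U (Real.exp (-τ)) θ)) ℓ := by
    intro θ
    have hU := pd_add_period (F := S.U) (ℓ := ℓ) (c := 0)
      (fun R hR θ => by simp [(hc R hR θ).1]) hR θ 1
    have h2 := (hc _ hR θ).2.2.1
    simp only [hU, h2]
  have h := negSobolevNorm_le hS.length_pos (by norm_num : (0 : ℝ) ≤ 1 / 2) ca (hS.a_pos _ hR)
    (fun θ => ((sa.hasDerivAt_snd hR θ).mul ((sU.pd 1).hasDerivAt_snd hR θ)).const_mul
      (Real.exp (-τ) ^ 2))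
    (((ca1.mul cU1).add (ca.mul cU2)).const_mul _) hgp cσ
  have e1 : S.avtdTerm τ = fun θ => S.a (Real.exp (-τ)) θ
        * (Real.exp (-τ) ^ 2 * (pd 1 S.a (Real.exp (-τ)) θ * pd 1 S.U (Real.exp (-τ)) θ
          + S.a (Real.exp (-τ)) θ * pd 1 (pd 1 S.U) (Real.exp (-τ)) θ))
      - 1 / 2 * S.spatialTerm τ θ := funext (hS.avtdTerm_eq hR)
  rw [e1]
  refine h.trans (le_of_eq ?_)
  rw [← intervalIntegral.integral_const_mul]
  congr 4
  funext θ
  have := (hS.a_pos _ hR θ).ne'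
  simp only [Pi.mul_apply]
  field_simp

/-- The energy decreases in `τ`, so its derivative is integrable up to `τ = ∞`. -/
theorem integrableOn_deriv_energy (hS : S.IsTwistedVacuum ℓ R₁ K) {τ₀ : ℝ}
    (hτ₀ : Real.exp (-τ₀) < R₁) :
    IntegrableOn (fun τ => Real.exp (-τ)
      * ∫ θ in (0 : ℝ)..ℓ, pd 0 (S.energyDensity K) (Real.exp (-τ)) θ) (Ioi τ₀) := by
  have hmem : ∀ τ ∈ Ici τ₀, Real.exp (-τ) ∈ Ioo 0 R₁ := fun τ hτ =>
    ⟨Real.exp_pos _, (Real.exp_le_exp.2 (neg_le_neg hτ)).trans_lt hτ₀⟩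
  set E : ℝ → ℝ := fun τ => ∫ θ in (0 : ℝ)..ℓ, S.energyDensity K (Real.exp (-τ)) θ
  have hderiv : ∀ τ ∈ Ici τ₀, HasDerivAt E (-(Real.exp (-τ)
      * ∫ θ in (0 : ℝ)..ℓ, pd 0 (S.energyDensity K) (Real.exp (-τ)) θ)) τ := by
    intro τ hτ
    have := (hS.hasDerivAt_energy (hmem τ hτ)).comp τ (hasDerivAt_exp_neg τ)
    rw [mul_comm, neg_mul] at this
    exact this
  have hneg : ∀ τ ∈ Ici τ₀, -(Real.exp (-τ)
      * ∫ θ in (0 : ℝ)..ℓ, pd 0 (S.energyDensity K) (Real.exp (-τ)) θ) ≤ 0 := by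
    intro τ hτ
    have hR := hmem τ hτ
    have h1 := hS.le_deriv_energy hR
    have h2 : 0 ≤ ∫ θ in (0 : ℝ)..ℓ, S.a (Real.exp (-τ)) θ * pd 1 S.U (Real.exp (-τ)) θ ^ 2 :=
      intervalIntegral.integral_nonneg hS.length_pos.le fun θ _ =>
        mul_nonneg (hS.a_pos _ hR θ).le (sq_nonneg _)
    have h3 := hR.1
    have h4 := (mul_nonneg (mul_nonneg zero_le_two h3.le) h2).trans h1
    exact neg_nonpos.2 (mul_nonneg h3.le h4)
  have hanti : AntitoneOn E (Ici τ₀) := by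
    refine antitoneOn_of_deriv_nonpos (convex_Ici τ₀)
      (fun τ hτ => (hderiv τ hτ).continuousAt.continuousWithinAt) (fun τ hτ => ?_) fun τ hτ => ?_
    · exact (hderiv τ (interior_subset hτ)).differentiableAt.differentiableWithinAt
    · rw [(hderiv τ (interior_subset hτ)).deriv]
      exact hneg τ (interior_subset hτ)
  have hlim : Tendsto (fun τ => E (max τ₀ τ)) atTop (nhds (⨅ τ, E (max τ₀ τ))) := by
    refine tendsto_atTop_ciInf (fun s t hst => ?_) ⟨0, ?_⟩
    · exact hanti (mem_Ici.2 (le_max_left _ _)) (mem_Ici.2 (le_max_left _ _)) (max_le_max_left _ hst)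
    · rintro _ ⟨τ, rfl⟩
      exact hS.energy_nonneg (hmem _ (mem_Ici.2 (le_max_left _ _)))
  have hlim' : Tendsto E atTop (nhds (⨅ τ, E (max τ₀ τ))) := by
    refine hlim.congr' ?_
    filter_upwards [eventually_ge_atTop τ₀] with τ hτ
    rw [max_eq_right hτ]
  have := (integrableOn_Ioi_deriv_of_nonpos' hderiv
    (fun τ hτ => hneg τ (Ioi_subset_Ici_self hτ)) hlim').neg
  simpa using this

end ArealCoeffs.IsTwistedVacuum

/-! ### Integrability in time -/

theorem ENNReal.add_sq_le_four_mul (x y : ℝ≥0∞) : (x + y) ^ 2 ≤ 4 * x ^ 2 + 4 * y ^ 2 := by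
  have h : x + y ≤ 2 * max x y := by
    rw [two_mul]
    exact add_le_add (le_max_left _ _) (le_max_right _ _)
  calc (x + y) ^ 2 ≤ (2 * max x y) ^ 2 := pow_le_pow_left' h 2
    _ = 4 * max x y ^ 2 := by rw [mul_pow]; norm_num
    _ ≤ 4 * x ^ 2 + 4 * y ^ 2 := by
      rcases max_cases x y with ⟨h, -⟩ | ⟨h, -⟩ <;> rw [h]
      · exact le_self_add
      · exact le_add_self

theorem theorem0p6 (S : ArealCoeffs) (ℓ R₁ K τ₀ : ℝ)
    (hS : S.IsTwistedVacuum ℓ R₁ K)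
    (hτ₀ : Real.exp (-τ₀) < R₁)
    (hH : ∃ B : ℝ, ∀ᶠ τ in atTop, B ≤ ∫ θ in (0 : ℝ)..ℓ, S.H (Real.exp (-τ)) θ)
    (hA : weightedNormIntegral ℓ τ₀ (fun τ θ => S.a (Real.exp (-τ)) θ) S.spatialTerm < ⊤) :
    weightedNormIntegral ℓ τ₀ (fun τ θ => S.a (Real.exp (-τ)) θ) S.avtdTerm < ⊤ := by
  have hint := hS.integrableOn_deriv_energy hτ₀
  set d : ℝ → ℝ := fun τ => Real.exp (-τ)
      * ∫ θ in (0 : ℝ)..ℓ, pd 0 (S.energyDensity K) (Real.exp (-τ)) θ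
  have hbound : ∀ τ ∈ Ioi τ₀, ENNReal.ofReal (Real.exp (2 * τ))
        * negSobolevNorm ℓ (S.a (Real.exp (-τ))) (S.avtdTerm τ) ^ 2
      ≤ ENNReal.ofReal (2 * d τ) + ENNReal.ofReal (Real.exp (2 * τ))
        * negSobolevNorm ℓ (S.a (Real.exp (-τ))) (S.spatialTerm τ) ^ 2 := by
    intro τ hτ
    have hR : Real.exp (-τ) ∈ Ioo 0 R₁ :=
      ⟨Real.exp_pos _, (Real.exp_le_exp.2 (neg_le_neg (le_of_lt hτ))).trans_lt hτ₀⟩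
    have h1 := hS.negSobolevNorm_avtdTerm_le hR
    have h2 := hS.le_deriv_energy hR
    have h0 : 0 ≤ ∫ θ in (0 : ℝ)..ℓ, S.a (Real.exp (-τ)) θ * pd 1 S.U (Real.exp (-τ)) θ ^ 2 :=
      intervalIntegral.integral_nonneg hS.length_pos.le fun θ _ =>
        mul_nonneg (hS.a_pos _ hR θ).le (sq_nonneg _)
    set I := ∫ θ in (0 : ℝ)..ℓ, S.a (Real.exp (-τ)) θ * pd 1 S.U (Real.exp (-τ)) θ ^ 2
    set N := negSobolevNorm ℓ (S.a (Real.exp (-τ))) (S.spatialTerm τ)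
    have hr : Real.exp (2 * τ) * (4 * (Real.exp (-τ) ^ 4 * I)) ≤ 2 * d τ := by
      have e2 : Real.exp (2 * τ) * Real.exp (-τ) ^ 2 = 1 := by
        rw [← Real.exp_nat_mul, ← Real.exp_add]; simp
      have h3 := mul_le_mul_of_nonneg_left h2 hR.1.le
      calc Real.exp (2 * τ) * (4 * (Real.exp (-τ) ^ 4 * I))
          = (Real.exp (2 * τ) * Real.exp (-τ) ^ 2) * (4 * (Real.exp (-τ) ^ 2 * I)) := by ring
        _ = 2 * (Real.exp (-τ) * (2 * Real.exp (-τ) * I)) := by rw [e2]; ring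
        _ ≤ 2 * d τ := mul_le_mul_of_nonneg_left h3 zero_le_two
    calc ENNReal.ofReal (Real.exp (2 * τ))
          * negSobolevNorm ℓ (S.a (Real.exp (-τ))) (S.avtdTerm τ) ^ 2
        ≤ ENNReal.ofReal (Real.exp (2 * τ))
          * (4 * ENNReal.ofReal (Real.sqrt (Real.exp (-τ) ^ 4 * I)) ^ 2
            + 4 * (ENNReal.ofReal (1 / 2) * N) ^ 2) := by
          gcongr
          exact (pow_le_pow_left' h1 2).trans (ENNReal.add_sq_le_four_mul _ _)
      _ = ENNReal.ofReal (Real.exp (2 * τ) * (4 * (Real.exp (-τ) ^ 4 * I)))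
          + ENNReal.ofReal (Real.exp (2 * τ)) * N ^ 2 := by
          have hh : (4 : ℝ≥0∞) * ENNReal.ofReal (1 / 2) ^ 2 = 1 := by
            rw [← ENNReal.ofReal_pow (by norm_num), show (4 : ℝ≥0∞) = ENNReal.ofReal 4 by simp,
              ← ENNReal.ofReal_mul (by norm_num)]
            norm_num
          rw [mul_add, mul_pow, ← mul_assoc 4 (ENNReal.ofReal (1 / 2) ^ 2), hh, one_mul,
            ← ENNReal.ofReal_pow (Real.sqrt_nonneg _), Real.sq_sqrt (by positivity),
            show (4 : ℝ≥0∞) = ENNReal.ofReal 4 by simp, ← ENNReal.ofReal_mul (by norm_num),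
            ← ENNReal.ofReal_mul (Real.exp_pos _).le]
      _ ≤ _ := by gcongr
  refine (setLIntegral_mono' measurableSet_Ioi hbound).trans_lt ?_
  rw [lintegral_add_left' (hint.const_mul 2).aestronglyMeasurable.aemeasurable.ennreal_ofReal]
  exact ENNReal.add_lt_top.2 ⟨(hint.const_mul 2).lintegral_lt_top, hA⟩
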